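/- Let $r_0>0$, $D=\{(x_1,x_2)\in\mathbb R^2:\sqrt{x_1^2+x_2^2}>r_0\}$, and use cylindrical coordinates $r=\sqrt{x_1^2+x_2^2}$, $\theta$, $z=x_3$ with the frame $e_r=(x_1/r,x_2/r,0)$, $e_\theta=(-x_2/r,x_1/r,0)$, $e_z=(0,0,1)$. Let $(v,p)$, with $v:D\times\mathbb R\to\mathbb R^3$ and $p:D\times\mathbb R\to\mathbb R$, be a smooth solution of the steady Navier–Stokes equations $$(v\cdot\nabla)v+\nabla p=\Delta v,\qquad \nabla\cdot v=0\qquad\text{in } D\times\mathbb R,$$ with $v(x_1,x_2,x_3+2\pi)=v(x_1,x_2,x_3)$. Assume that $(v,p)$ is axisymmetric, that is, $p$ and the components $v^r,v^\theta,v^z$ of $v=v^re_r+v^\theta e_\theta+v^ze_z$ do not depend on $\theta$, and that $v$ has no swirl, that is, $v^\theta\equiv0$. Assume further that $$\int_{D\times[-\pi,\pi]}|\nabla v(x)|^q\,dx<\infty$$ for some $q\in[2,\infty)$. Let $\omega^\theta=\omega^\theta(r,z)$ be the $e_\theta$-component of the vorticity $\nabla\times v$, so that $\omega^\theta=\partial_zv^r-\partial_rv^z$,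 and let $\Omega=\omega^\theta/r$. Then $$\lim_{r\to\infty}r^{1+2/q-1/q^2}\sup_{z\in[-\pi,\pi]}|\Omega(r,z)|=0\quad\text{if }q>2,\qquad \lim_{r\to\infty}r^{3/2}\sup_{z\in[-\pi,\pi]}|\Omega(r,z)|=0\quad\text{if }q=2,$$ and $$\lim_{r\to\infty}r^{2/q-1/q^2}\sup_{z\in[-\pi,\pi]}|\omega^\theta(r,z)|=0\quad\text{if }q>2,\qquad \lim_{r\to\infty}r^{1/2}\sup_{z\in[-\pi,\pi]}|\omega^\theta(r,z)|=0\quad\text{if }q=2.$$ -/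

import Mathlib

open MeasureTheory Filter Topology Set
open scoped ContDiff

noncomputable section

/-- Three-dimensional Euclidean space, with coordinates `x 0`, `x 1`, `x 2`
(usually written `x₁, x₂, x₃`). -/
abbrev E3 : Type := EuclideanSpace ℝ (Fin 3)

/-- The distance to the `x₃`-axis, `r = √(x₁² + x₂²)`. -/
def cylRadius (x : E3) : ℝ := Real.sqrt (x 0 ^ 2 + x 1 ^ 2)

/-- The exterior `D × ℝ` of the infinite cylinder of radius `r₀`. -/
def cylExterior (r₀ : ℝ) : Set E3 := {x | r₀ < cylRadius x}

/-- One period cell `D × [-π, π]` of the exterior of the cylinder. -/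
def periodCell (r₀ : ℝ) : Set E3 :=
  {x | r₀ < cylRadius x ∧ x 2 ∈ Icc (-Real.pi) Real.pi}

/-- The point with cylindrical coordinates `(r, θ, z)`. -/
def cylPoint (r θ z : ℝ) : E3 := !₂[r * Real.cos θ, r * Real.sin θ, z]

/-- The unit vector `e_r = (x₁/r, x₂/r, 0)`. -/
def eRad (x : E3) : E3 := !₂[x 0 / cylRadius x, x 1 / cylRadius x, 0]

/-- The unit vector `e_θ = (-x₂/r, x₁/r, 0)`. -/
def eAng (x : E3) : E3 := !₂[-(x 1) / cylRadius x, x 0 / cylRadius x, 0]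

/-- The unit vector `e_z = (0, 0, 1)`. -/
def eAx : E3 := !₂[0, 0, 1]

/-- The radial component `v^r` of a vector field. -/
def radialComp (v : E3 → E3) (x : E3) : ℝ := inner ℝ (v x) (eRad x)

/-- The angular component `v^θ` of a vector field. -/
def angularComp (v : E3 → E3) (x : E3) : ℝ := inner ℝ (v x) (eAng x)

/-- The axial component `v^z` of a vector field. -/
def axialComp (v : E3 → E3) (x : E3) : ℝ := inner ℝ (v x) eAx

/-- A scalar function on the exterior of the cylinder is axially symmetric if it does not
depend on the angle, that is, if it depends only on `r` and `z`. -/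
def AxisymScalar (r₀ : ℝ) (f : E3 → ℝ) : Prop :=
  ∀ x ∈ cylExterior r₀, ∀ y ∈ cylExterior r₀,
    cylRadius x = cylRadius y → x 2 = y 2 → f x = f y

/-- A vector field on the exterior of the cylinder is axially symmetric if its components
`v^r`, `v^θ`, `v^z` in the frame `e_r, e_θ, e_z` do not depend on the angle. -/
def AxisymVector (r₀ : ℝ) (v : E3 → E3) : Prop :=
  AxisymScalar r₀ (radialComp v) ∧ AxisymScalar r₀ (angularComp v) ∧
    AxisymScalar r₀ (axialComp v)

/-- A vector field on the exterior of the cylinder has no swirl if `v^θ = 0`. -/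
def NoSwirl (r₀ : ℝ) (v : E3 → E3) : Prop :=
  ∀ x ∈ cylExterior r₀, angularComp v x = 0

/-- The partial derivative `∂_j v_i` at `x`. -/
def partialD (v : E3 → E3) (j i : Fin 3) (x : E3) : ℝ :=
  fderiv ℝ v x (EuclideanSpace.single j 1) i

/-- The divergence `∇ · v`. -/
def divergence (v : E3 → E3) (x : E3) : ℝ := ∑ i, partialD v i i x

/-- The vorticity `ω = ∇ × v`. -/
def curl (v : E3 → E3) (x : E3) : E3 :=
  !₂[partialD v 1 2 x - partialD v 2 1 x,
     partialD v 2 0 x - partialD v 0 2 x,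
     partialD v 0 1 x - partialD v 1 0 x]

/-- The Euclidean (Frobenius) norm `|∇v|` of the matrix of first derivatives. -/
def gradNorm (v : E3 → E3) (x : E3) : ℝ :=
  Real.sqrt (∑ i, ∑ j, partialD v j i x ^ 2)

/-- `(v, p)` is a smooth solution of the steady Navier–Stokes equations
`(v · ∇) v + ∇p = Δv`, `∇ · v = 0` in the exterior of the cylinder of radius `r₀`,
with `v` being `2π`-periodic in `x₃`. -/
structure IsPeriodicSteadyNS (r₀ : ℝ) (v : E3 → E3) (p : E3 → ℝ) : Prop where
  smooth_v : ContDiffOn ℝ ∞ v (cylExterior r₀)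
  smooth_p : ContDiffOn ℝ ∞ p (cylExterior r₀)
  momentum : ∀ x ∈ cylExterior r₀,
    fderiv ℝ v x (v x) + gradient p x = Laplacian.laplacian v x
  div_free : ∀ x ∈ cylExterior r₀, divergence v x = 0
  periodic : ∀ x ∈ cylExterior r₀,
    v (x + EuclideanSpace.single 2 (2 * Real.pi)) = v x

/-- The angular component `ω^θ` of the vorticity. -/
def omegaTheta (v : E3 → E3) (x : E3) : ℝ := angularComp (curl v) x

/-- The quantity `Ω = ω^θ / r`. -/
def bigOmega (v : E3 → E3) (x : E3) : ℝ := omegaTheta v x / cylRadius x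

/-- The supremum over `z ∈ [-π, π]` of `|f|` at the points with cylindrical coordinates
`(r, θ, z)`. For `f` continuous outside the cylinder and `r > r₀` it is a supremum of a
continuous function over a compact interval. -/
def supZ (f : E3 → ℝ) (θ r : ℝ) : ℝ :=
  ⨆ z : Icc (-Real.pi) Real.pi, |f (cylPoint r θ z)|

end

/-! Write U = v^r, W = v^z and Ω = ω^θ/r as functions of (r, z). Without swirl, taking the curl of
the momentum equation removes the pressure, and division by r removes vortex stretching: U ∂_rΩ + W
∂_zΩ = ∂_r²Ω + (3/r) ∂_rΩ + ∂_z²Ω. There is no zeroth-order term, so |Ω| on an annulus is bounded by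
its values on the two boundary cylinders (`abs_le_of_boundary_le`). It is therefore enough to find,
in every large dyadic annulus, one cylinder on which Ω is small.

Such a cylinder comes from a local energy estimate. Multiplication of the equation by rΩ shows that
the flux E(r) of `energyFlux` has the dissipation ∫ r|∇Ω|² dz as its derivative
(`hasDerivAt_energyFlux`). Testing with a squared cutoff bounds the dissipation on [R, 2R] by a
multiple, independent of R, of ∫∫ Ω² over [R/2, 4R] (`integral_dissipation_le`). The obstacle is the
convective term, which needs control of U. The flux of U through cylinders is constant, so |U| ≤ c +
∫|∂_zU| dz, and this bound is controlled only on average in r. The cutoff is therefore given a slope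
proportional to the reciprocal of the velocity bound: it varies slowly where U may be large, while
its total variation is still of order R because the mean of a reciprocal is at least the reciprocal
of the mean (`le_integral_inv`).

A minimum argument in r and a Sobolev inequality in z then give a cylinder with R sup Ω² ≤ K ∫∫ Ω²
(`exists_good_radius`). The hypothesis on ∇v makes ∫ r ∫ |rΩ|^q dz dr finite, so its part over [R/2,
4R] tends to zero; interpolation at the level l = e R^{-(1+2/q)} gives sup|Ω| = o(R^{-(1+2/q)}) on
the good cylinder. The maximum principle carries this to all r. The resulting exponent 1 + 2/q is at
least as large as the stated ones for every q ≥ 2. -/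

/-! ### Calculus in the meridional half plane -/

/-- The half plane `r > r₀` of the coordinates `(r, z)`. -/
def meridian (r₀ : ℝ) : Set (ℝ × ℝ) := {x | r₀ < x.1}

/-- The partial derivative in the first variable. -/
noncomputable def dR (F : ℝ × ℝ → ℝ) (x : ℝ × ℝ) : ℝ := fderiv ℝ F x (1, 0)

/-- The partial derivative in the second variable. -/
noncomputable def dZ (F : ℝ × ℝ → ℝ) (x : ℝ × ℝ) : ℝ := fderiv ℝ F x (0, 1)

/-- Smoothness in the half plane `r > r₀`. -/
def SmoothMer (r₀ : ℝ) (F : ℝ × ℝ → ℝ) : Prop := ContDiffOn ℝ ∞ F (meridian r₀)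

lemma isOpen_meridian (r₀ : ℝ) : IsOpen (meridian r₀) :=
  isOpen_lt continuous_const continuous_fst

namespace SmoothMer

variable {r₀ : ℝ} {F G : ℝ × ℝ → ℝ}

lemma contDiffAt (hF : SmoothMer r₀ F) {r z : ℝ} (hr : r₀ < r) : ContDiffAt ℝ ∞ F (r, z) :=
  ContDiffOn.contDiffAt hF ((isOpen_meridian r₀).mem_nhds hr)

lemma differentiableAt (hF : SmoothMer r₀ F) {r z : ℝ} (hr : r₀ < r) :
    DifferentiableAt ℝ F (r, z) := (hF.contDiffAt hr).differentiableAt (by simp)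

lemma continuousOn (hF : SmoothMer r₀ F) : ContinuousOn F (meridian r₀) :=
  ContDiffOn.continuousOn hF

lemma fderiv_apply (hF : SmoothMer r₀ F) (e : ℝ × ℝ) :
    SmoothMer r₀ (fun x => fderiv ℝ F x e) :=
  (ContDiffOn.fderiv_of_isOpen hF (isOpen_meridian r₀) (by simp)).clm_apply contDiffOn_const

lemma dR (hF : SmoothMer r₀ F) : SmoothMer r₀ (dR F) := hF.fderiv_apply _

lemma dZ (hF : SmoothMer r₀ F) : SmoothMer r₀ (dZ F) := hF.fderiv_apply _

lemma add (hF : SmoothMer r₀ F) (hG : SmoothMer r₀ G) : SmoothMer r₀ (fun x => F x + G x) :=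
  ContDiffOn.add hF hG

lemma sub (hF : SmoothMer r₀ F) (hG : SmoothMer r₀ G) : SmoothMer r₀ (fun x => F x - G x) :=
  ContDiffOn.sub hF hG

lemma mul (hF : SmoothMer r₀ F) (hG : SmoothMer r₀ G) : SmoothMer r₀ (fun x => F x * G x) :=
  ContDiffOn.mul hF hG

lemma const (r₀ c : ℝ) : SmoothMer r₀ (fun _ => c) := contDiffOn_const

lemma fst (r₀ : ℝ) : SmoothMer r₀ (fun x => x.1) := contDiff_fst.contDiffOn

lemma div_fst (hr₀ : 0 ≤ r₀) (hF : SmoothMer r₀ F) : SmoothMer r₀ (fun x => F x / x.1) :=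
  ContDiffOn.div hF contDiff_fst.contDiffOn fun _ hx => (hr₀.trans_lt hx).ne'

lemma hasDerivAt_r (hF : SmoothMer r₀ F) {r : ℝ} (z : ℝ) (hr : r₀ < r) :
    HasDerivAt (fun s => F (s, z)) (_root_.dR F (r, z)) r := by
  have h := (hF.differentiableAt (z := z) hr).hasFDerivAt.comp_hasDerivAt r
    ((hasDerivAt_id r).prodMk (hasDerivAt_const r z))
  exact h

lemma hasDerivAt_z (hF : SmoothMer r₀ F) {r : ℝ} (z : ℝ) (hr : r₀ < r) :
    HasDerivAt (fun s => F (r, s)) (_root_.dZ F (r, z)) z := by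
  have h := (hF.differentiableAt (z := z) hr).hasFDerivAt.comp_hasDerivAt z
    ((hasDerivAt_const z r).prodMk (hasDerivAt_id z))
  exact h

lemma dR_dZ (hF : SmoothMer r₀ F) {r : ℝ} (z : ℝ) (hr : r₀ < r) :
    _root_.dR (_root_.dZ F) (r, z) = _root_.dZ (_root_.dR F) (r, z) := by
  have hs : IsSymmSndFDerivAt ℝ F (r, z) :=
    (hF.contDiffAt hr).isSymmSndFDerivAt (by simpa using WithTop.coe_le_coe.2 (le_top (a := (2 : ℕ∞))))
  have hd : DifferentiableAt ℝ (fderiv ℝ F) (r, z) :=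
    ((hF.contDiffAt hr).fderiv_right (m := 1) (WithTop.coe_le_coe.2 (le_top (a := (2 : ℕ∞))))).differentiableAt (by simp)
  have key : ∀ e e' : ℝ × ℝ, fderiv ℝ (fun x => fderiv ℝ F x e) (r, z) e'
      = fderiv ℝ (fderiv ℝ F) (r, z) e' e := by
    intro e e'
    rw [fderiv_clm_apply hd (differentiableAt_const e)]
    simp
  unfold _root_.dR _root_.dZ
  rw [key, key]
  exact hs _ _

end SmoothMer

lemma ContinuousOn.slice_z {r₀ r : ℝ} {F : ℝ × ℝ → ℝ} (hF : ContinuousOn F (meridian r₀))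
    (hr : r₀ < r) : Continuous fun z => F (r, z) :=
  hF.comp_continuous (by fun_prop) fun _ => hr

/-- Supplies the constant dominating function for passing to the limit and differentiating under the
integral over a period. -/
lemma exists_bound_near {r₀ r : ℝ} {F : ℝ × ℝ → ℝ} (hF : ContinuousOn F (meridian r₀))
    (hr : r₀ < r) : ∃ δ > 0, r₀ < r - δ ∧ ∃ C, ∀ s ∈ Metric.ball r δ,
      ∀ z ∈ Icc (-Real.pi) Real.pi, |F (s, z)| ≤ C := by
  refine ⟨(r - r₀) / 2, by linarith, by linarith, ?_⟩
  have hK : IsCompact (Icc (r - (r - r₀) / 2) (r + (r - r₀) / 2) ×ˢ Icc (-Real.pi) Real.pi) :=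
    isCompact_Icc.prod isCompact_Icc
  obtain ⟨C, hC⟩ := hK.exists_bound_of_continuousOn (hF.mono (by
    rintro ⟨s, z⟩ ⟨hs, -⟩
    have := hs.1
    simp only [meridian, mem_ofPred_eq] at this ⊢
    linarith))
  refine ⟨C, fun s hs z hz => hC (s, z) ⟨?_, hz⟩⟩
  rw [Metric.mem_ball, Real.dist_eq, abs_lt] at hs
  constructor <;> linarith [hs.1, hs.2]

lemma mem_Icc_of_mem_uIoc_pi {z : ℝ} (hz : z ∈ Set.uIoc (-Real.pi) Real.pi) :
    z ∈ Icc (-Real.pi) Real.pi := by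
  rw [uIoc_of_le (by linarith [Real.pi_pos])] at hz
  exact Ioc_subset_Icc_self hz

lemma ContinuousOn.integral_slice {r₀ : ℝ} {F : ℝ × ℝ → ℝ} (hF : ContinuousOn F (meridian r₀)) :
    ContinuousOn (fun r => ∫ z in (-Real.pi)..Real.pi, F (r, z)) (Ioi r₀) := by
  intro r hr
  obtain ⟨δ, hδ, hrδ, C, hC⟩ := exists_bound_near hF hr
  refine ContinuousAt.continuousWithinAt ?_
  refine intervalIntegral.continuousAt_of_dominated_interval (bound := fun _ => C) ?_ ?_ ?_ ?_
  · filter_upwards [Ioi_mem_nhds hr] with s hs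
    exact (hF.slice_z hs).aestronglyMeasurable
  · filter_upwards [Metric.ball_mem_nhds r hδ] with s hs
    filter_upwards with z hz
    exact hC s hs z (mem_Icc_of_mem_uIoc_pi hz)
  · simp
  · filter_upwards with z _
    have h1 : ContinuousAt F (r, z) := hF.continuousAt ((isOpen_meridian r₀).mem_nhds hr)
    exact h1.comp (f := fun s : ℝ => (s, z)) (by fun_prop)

lemma SmoothMer.hasDerivAt_integral {r₀ r : ℝ} {F : ℝ × ℝ → ℝ} (hF : SmoothMer r₀ F)
    (hr : r₀ < r) :
    HasDerivAt (fun r => ∫ z in (-Real.pi)..Real.pi, F (r, z))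
      (∫ z in (-Real.pi)..Real.pi, _root_.dR F (r, z)) r := by
  obtain ⟨δ, hδ, hrδ, C, hC⟩ := exists_bound_near hF.dR.continuousOn hr
  refine (intervalIntegral.hasDerivAt_integral_of_dominated_loc_of_deriv_le
    (bound := fun _ => C) (F' := fun s z => _root_.dR F (s, z)) (Metric.ball_mem_nhds r hδ)
    ?_ ?_ ?_ ?_ ?_ ?_).2
  · filter_upwards [Ioi_mem_nhds hr] with s hs
    exact (hF.continuousOn.slice_z hs).aestronglyMeasurable
  · exact (hF.continuousOn.slice_z hr).intervalIntegrable _ _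
  · exact (hF.dR.continuousOn.slice_z hr).aestronglyMeasurable
  · filter_upwards with z hz s hs
    exact hC s hs z (mem_Icc_of_mem_uIoc_pi hz)
  · simp
  · filter_upwards with z _ s hs
    refine hF.hasDerivAt_r z ?_
    rw [Metric.mem_ball, Real.dist_eq, abs_lt] at hs
    linarith [hs.1]

/-- Periodicity in `z` with period `2π` in the half plane `r > r₀`. -/
def PeriodicMer (r₀ : ℝ) (F : ℝ × ℝ → ℝ) : Prop :=
  ∀ r z, r₀ < r → F (r, z + 2 * Real.pi) = F (r, z)

namespace PeriodicMer

variable {r₀ : ℝ} {F : ℝ × ℝ → ℝ}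

lemma fderiv_apply (hF : PeriodicMer r₀ F) (e : ℝ × ℝ) :
    PeriodicMer r₀ (fun x => fderiv ℝ F x e) := by
  intro r z hr
  have h1 : (fun x => F (x + (0, 2 * Real.pi))) =ᶠ[𝓝 (r, z)] F := by
    filter_upwards [(isOpen_meridian r₀).mem_nhds (x := (r, z)) hr] with x hx
    have := hF x.1 x.2 hx
    have h' : x + (0, 2 * Real.pi) = (x.1, x.2 + 2 * Real.pi) := by ext <;> simp
    simpa only [h'] using this
  have h2 := h1.fderiv_eq (𝕜 := ℝ)
  rw [fderiv_comp_add_right] at h2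
  have h3 : ((r, z) : ℝ × ℝ) + (0, 2 * Real.pi) = (r, z + 2 * Real.pi) := by simp
  rw [h3] at h2
  simp only [h2]

lemma dR (hF : PeriodicMer r₀ F) : PeriodicMer r₀ (dR F) := hF.fderiv_apply _

lemma dZ (hF : PeriodicMer r₀ F) : PeriodicMer r₀ (dZ F) := hF.fderiv_apply _

lemma pi_eq (hF : PeriodicMer r₀ F) {r : ℝ} (hr : r₀ < r) :
    F (r, Real.pi) = F (r, -Real.pi) := by
  have := hF r (-Real.pi) hr
  rwa [show -Real.pi + 2 * Real.pi = Real.pi by ring] at this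

/-- The integral over a period of a `z`-derivative of a periodic function vanishes. -/
lemma integral_dZ (hF : PeriodicMer r₀ F) (hs : SmoothMer r₀ F) {r : ℝ} (hr : r₀ < r) :
    ∫ z in (-Real.pi)..Real.pi, _root_.dZ F (r, z) = 0 := by
  rw [intervalIntegral.integral_eq_sub_of_hasDerivAt (fun z _ => hs.hasDerivAt_z z hr)
    ((hs.dZ.continuousOn.slice_z hr).intervalIntegrable _ _), hF.pi_eq hr, sub_self]

end PeriodicMer

/-! ### Cutoff argument and one-dimensional inequalities -/

/-- A differential inequality for a monotone function `E` with derivative `D`, obtained by testing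
with the square of the cutoff function `∫ₜᵈ h`. -/
lemma cutoff_right {c d A M κ : ℝ} (hcd : c ≤ d) {E D G B h : ℝ → ℝ}
    (hE : ∀ t ∈ Icc c d, HasDerivAt E (D t) t) (hD : ContinuousOn D (Icc c d))
    (hG : ContinuousOn G (Icc c d)) (hG0 : ∀ t ∈ Icc c d, 0 ≤ G t) (hh : Continuous h)
    (hh0 : ∀ t, 0 ≤ h t) (hh1 : ∀ t, h t ≤ 1) (hM : 0 ≤ M) (hA : 0 ≤ A)
    (hB : ∀ t ∈ Icc c d, h t * B t ≤ M) (hκ : 0 < κ) (hκh : κ ≤ ∫ t in c..d, h t)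
    (hbound : ∀ t ∈ Icc c d, ∀ x y : ℝ, 0 ≤ x → 0 ≤ y →
      2 * x * y * |E t| ≤ x ^ 2 * D t + (y ^ 2 * A + 2 * x * y * B t) * G t) :
    E c ≤ (A / κ ^ 2 + 2 * M / κ) * ∫ t in c..d, G t := by
  set H := ∫ t in c..d, h t with hHdef
  -- ψ vanishes at d, equals H at c and has slope -h. Integrating (ψ²E)' over [c, d] thus leaves
  -- only -H² E(c).
  set ψ : ℝ → ℝ := fun t => ∫ s in t..d, h s with hψ
  have hH0 : 0 < H := hκ.trans_le hκh
  have hψd : ∀ t, HasDerivAt ψ (-h t) t := fun t =>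
    intervalIntegral.integral_hasDerivAt_left (hh.intervalIntegrable _ _)
      (hh.stronglyMeasurableAtFilter _ _) hh.continuousAt
  have hψc : Continuous ψ := continuous_iff_continuousAt.2 fun t => (hψd t).continuousAt
  have hψ0 : ∀ t ∈ Icc c d, 0 ≤ ψ t := fun t ht =>
    intervalIntegral.integral_nonneg ht.2 fun s _ => hh0 s
  have hψH : ∀ t ∈ Icc c d, ψ t ≤ H := fun t ht => by
    have h1 : (∫ s in c..t, h s) + ψ t = H :=
      intervalIntegral.integral_add_adjacent_intervals (hh.intervalIntegrable _ _)
        (hh.intervalIntegrable _ _)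
    have h2 : 0 ≤ ∫ s in c..t, h s := intervalIntegral.integral_nonneg ht.1 fun s _ => hh0 s
    linarith
  have hEc : ContinuousOn E (Icc c d) := fun t ht => (hE t ht).continuousAt.continuousWithinAt
  have hder : ∀ t ∈ uIcc c d, HasDerivAt (fun t => ψ t ^ 2 * E t)
      (2 * ψ t * (-h t) * E t + ψ t ^ 2 * D t) t := by
    intro t ht
    rw [uIcc_of_le hcd] at ht
    exact (((hψd t).pow 2).mul (hE t ht)).congr_deriv (by simp)
  have hcont : ContinuousOn (fun t => 2 * ψ t * (-h t) * E t + ψ t ^ 2 * D t) (Icc c d) := by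
    have := hψc.continuousOn (s := Icc c d)
    have := hh.continuousOn (s := Icc c d)
    fun_prop
  have hint := intervalIntegral.integral_eq_sub_of_hasDerivAt hder
    (hcont.intervalIntegrable_of_Icc hcd)
  have hψd0 : ψ d = 0 := by simp [hψ]
  have hψcH : ψ c = H := rfl
  simp only [hψd0, hψcH] at hint
  have hmono : ∫ t in c..d, (-(A + 2 * H * M)) * G t ≤
      ∫ t in c..d, (2 * ψ t * (-h t) * E t + ψ t ^ 2 * D t) := by
    refine intervalIntegral.integral_mono_on hcd
      ((continuousOn_const.mul hG).intervalIntegrable_of_Icc hcd)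
      (hcont.intervalIntegrable_of_Icc hcd) fun t ht => ?_
    -- With x = ψ and y = h, the term 2ψh|E| from differentiating the cutoff is absorbed by ψ²D, up
    -- to a multiple of G. The bound hB ≤ M is needed only for the product, so B itself may be large
    -- where h is small.
    have h1 := hbound t ht (ψ t) (h t) (hψ0 t ht) (hh0 t)
    have h2 : 2 * ψ t * h t * E t ≤ 2 * ψ t * h t * |E t| :=
      mul_le_mul_of_nonneg_left (le_abs_self _)
        (mul_nonneg (mul_nonneg zero_le_two (hψ0 t ht)) (hh0 t))
    have h3 : h t ^ 2 * A ≤ A := by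
      have : h t ^ 2 ≤ 1 := pow_le_one₀ (hh0 t) (hh1 t)
      nlinarith
    have h4 : 2 * ψ t * h t * B t ≤ 2 * H * M := by
      have h5 : ψ t * (h t * B t) ≤ ψ t * M := mul_le_mul_of_nonneg_left (hB t ht) (hψ0 t ht)
      have h6 : ψ t * M ≤ H * M := mul_le_mul_of_nonneg_right (hψH t ht) hM
      linarith
    have h7 : (h t ^ 2 * A + 2 * ψ t * h t * B t) * G t ≤ (A + 2 * H * M) * G t :=
      mul_le_mul_of_nonneg_right (add_le_add h3 h4) (hG0 t ht)
    linarith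
  rw [intervalIntegral.integral_const_mul, hint] at hmono
  have hI : 0 ≤ ∫ t in c..d, G t := intervalIntegral.integral_nonneg hcd hG0
  have h1 : E c ≤ (A / H ^ 2 + 2 * M / H) * ∫ t in c..d, G t := by
    have h2 : (A / H ^ 2 + 2 * M / H) * (∫ t in c..d, G t)
        = ((A + 2 * H * M) * ∫ t in c..d, G t) / H ^ 2 := by
      field_simp
    rw [h2, le_div_iff₀ (by positivity)]
    linarith
  refine h1.trans (mul_le_mul_of_nonneg_right ?_ hI)
  gcongr

/-- The reflected form of `cutoff_right`. -/
lemma cutoff_left {a b A M κ : ℝ} (hab : a ≤ b) {E D G B h : ℝ → ℝ}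
    (hE : ∀ t ∈ Icc a b, HasDerivAt E (D t) t) (hD : ContinuousOn D (Icc a b))
    (hG : ContinuousOn G (Icc a b)) (hG0 : ∀ t ∈ Icc a b, 0 ≤ G t) (hh : Continuous h)
    (hh0 : ∀ t, 0 ≤ h t) (hh1 : ∀ t, h t ≤ 1) (hM : 0 ≤ M) (hA : 0 ≤ A)
    (hB : ∀ t ∈ Icc a b, h t * B t ≤ M) (hκ : 0 < κ) (hκh : κ ≤ ∫ t in a..b, h t)
    (hbound : ∀ t ∈ Icc a b, ∀ x y : ℝ, 0 ≤ x → 0 ≤ y →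
      2 * x * y * |E t| ≤ x ^ 2 * D t + (y ^ 2 * A + 2 * x * y * B t) * G t) :
    -E b ≤ (A / κ ^ 2 + 2 * M / κ) * ∫ t in a..b, G t := by
  have hm : ∀ t ∈ Icc (-b) (-a), -t ∈ Icc a b := fun t ht =>
    ⟨by linarith [ht.2], by linarith [ht.1]⟩
  have hmaps : MapsTo (fun t : ℝ => -t) (Icc (-b) (-a)) (Icc a b) := hm
  have key := cutoff_right (c := -b) (d := -a) (A := A) (M := M) (κ := κ) (by linarith)
    (E := fun t => -E (-t)) (D := fun t => D (-t)) (G := fun t => G (-t))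
    (B := fun t => B (-t)) (h := fun t => h (-t))
    (fun t ht => by
      exact (((hE _ (hm t ht)).comp t (hasDerivAt_neg t)).neg).congr_deriv (by simp))
    (hD.comp continuousOn_neg hmaps) (hG.comp continuousOn_neg hmaps)
    (fun t ht => hG0 _ (hm t ht)) (hh.comp continuous_neg) (fun t => hh0 _) (fun t => hh1 _)
    hM hA (fun t ht => hB _ (hm t ht)) hκ
    (by rw [intervalIntegral.integral_comp_neg]; simpa using hκh)
    (fun t ht x y hx hy => by simpa using hbound _ (hm t ht) x y hx hy)
  rw [intervalIntegral.integral_comp_neg] at key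
  simpa using key

/-- A lower bound for the integral of a reciprocal. -/
lemma le_integral_inv {a b C : ℝ} (hab : a < b) {f : ℝ → ℝ} (hf : Continuous f)
    (hf0 : ∀ t, 0 < f t) (hC : 0 < C) (hfC : ∫ t in a..b, f t ≤ C * (b - a)) :
    (b - a) / C ≤ ∫ t in a..b, (f t)⁻¹ := by
  have hinv : Continuous fun t => (f t)⁻¹ := hf.inv₀ fun t => (hf0 t).ne'
  -- The integrand on the left is the tangent line at C of the convex function x ↦ 1/x, evaluated at
  -- f t.
  have h1 : ∫ t in a..b, (2 / C - f t / C ^ 2) ≤ ∫ t in a..b, (f t)⁻¹ := by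
    refine intervalIntegral.integral_mono_on hab.le
      ((by fun_prop : Continuous fun t => 2 / C - f t / C ^ 2).intervalIntegrable _ _)
      (hinv.intervalIntegrable _ _) fun t _ => ?_
    have := hf0 t
    rw [← sub_nonneg]
    have h2 : (f t)⁻¹ - (2 / C - f t / C ^ 2) = (C - f t) ^ 2 / (f t * C ^ 2) := by
      field_simp
      ring
    rw [h2]
    positivity
  have h3 : ∫ t in a..b, (2 / C - f t / C ^ 2)
      = (b - a) * (2 / C) - (∫ t in a..b, f t) / C ^ 2 := by
    rw [intervalIntegral.integral_sub (by simp)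
      ((hf.div_const _).intervalIntegrable _ _)]
    simp only [intervalIntegral.integral_const, smul_eq_mul, intervalIntegral.integral_div]
    ring
  rw [h3] at h1
  have h4 : (∫ t in a..b, f t) / C ^ 2 ≤ C * (b - a) / C ^ 2 := by gcongr
  have h5 : C * (b - a) / C ^ 2 = (b - a) / C := by field_simp
  have h6 : (b - a) * (2 / C) = 2 * ((b - a) / C) := by ring
  linarith

/-! ### Meridional flows: flux, velocity bound and energy identity -/

/-- The velocity components `U = v^r`, `W = v^z` and the quantity `Om = ω^θ / r` of an axisymmetric
flow without swirl, as functions of `(r, z)`. -/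
structure MeridionalFlow (r₀ : ℝ) (U W Om : ℝ × ℝ → ℝ) : Prop where
  nonneg : 0 ≤ r₀
  smooth_U : SmoothMer r₀ U
  smooth_W : SmoothMer r₀ W
  smooth_Om : SmoothMer r₀ Om
  periodic_U : PeriodicMer r₀ U
  periodic_W : PeriodicMer r₀ W
  periodic_Om : PeriodicMer r₀ Om
  div_free : ∀ r z, r₀ < r → U (r, z) + r * (dR U (r, z) + dZ W (r, z)) = 0
  vorticity : ∀ r z, r₀ < r → U (r, z) * dR Om (r, z) + W (r, z) * dZ Om (r, z) =
    dR (dR Om) (r, z) + 3 / r * dR Om (r, z) + dZ (dZ Om) (r, z)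

/-- A one-dimensional Sobolev inequality on `[-π, π]`. -/
lemma two_pi_mul_le {f f' : ℝ → ℝ} (hf : ∀ z, HasDerivAt f (f' z) z) (hf' : Continuous f')
    {z : ℝ} (hz : z ∈ Icc (-Real.pi) Real.pi) :
    2 * Real.pi * f z ≤ (∫ s in (-Real.pi)..Real.pi, f s)
      + 2 * Real.pi * ∫ s in (-Real.pi)..Real.pi, |f' s| := by
  have hπ := Real.pi_pos
  have hfc : Continuous f := continuous_iff_continuousAt.2 fun t => (hf t).continuousAt
  set A := ∫ s in (-Real.pi)..Real.pi, |f' s|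
  have h1 : ∀ s ∈ Icc (-Real.pi) Real.pi, f z ≤ f s + A := by
    intro s hs
    have h2 : ∫ t in s..z, f' t = f z - f s :=
      intervalIntegral.integral_eq_sub_of_hasDerivAt (fun t _ => hf t)
        (hf'.intervalIntegrable _ _)
    have h3 : |∫ t in s..z, f' t| ≤ |∫ t in s..z, (|f' t|)| :=
      by simpa only [Real.norm_eq_abs] using
        intervalIntegral.norm_integral_le_abs_integral_norm (f := f') (μ := volume) (a := s) (b := z)
    have h4 : |∫ t in s..z, (|f' t|)| ≤ |∫ t in (-Real.pi)..Real.pi, (|f' t|)| := by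
      refine intervalIntegral.abs_integral_mono_interval ?_ ?_ (hf'.abs.intervalIntegrable _ _)
      · rw [uIoc, uIoc]
        refine Ioc_subset_Ioc ?_ ?_
        · rw [min_eq_left (by linarith)]
          exact le_min hs.1 hz.1
        · rw [max_eq_right (by linarith : -Real.pi ≤ Real.pi)]
          exact max_le hs.2 hz.2
      · filter_upwards with t
        exact abs_nonneg _
    have h5 : |A| = A :=
      abs_of_nonneg (intervalIntegral.integral_nonneg (by linarith) fun t _ => abs_nonneg _)
    have h6 := (le_abs_self (∫ t in s..z, f' t)).trans (h3.trans h4)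
    rw [h5] at h6
    linarith
  have h7 : ∫ _ in (-Real.pi)..Real.pi, f z ≤ ∫ s in (-Real.pi)..Real.pi, (f s + A) :=
    intervalIntegral.integral_mono_on (by linarith) (by simp)
      ((hfc.add continuous_const).intervalIntegrable _ _) h1
  rw [intervalIntegral.integral_add (hfc.intervalIntegrable _ _) (by simp)] at h7
  simp only [intervalIntegral.integral_const, smul_eq_mul] at h7
  linarith

namespace MeridionalFlow

variable {r₀ : ℝ} {U W Om : ℝ × ℝ → ℝ}

/-- The flux through the cylinder of radius `r` does not depend on `r`. -/
lemma flux_const (h : MeridionalFlow r₀ U W Om) :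
    ∃ c, ∀ r, r₀ < r → ∫ z in (-Real.pi)..Real.pi, r * U (r, z) = c := by
  have hs : SmoothMer r₀ (fun x => x.1 * U x) := (SmoothMer.fst r₀).mul h.smooth_U
  have hd : ∀ r, r₀ < r → HasDerivAt (fun r => ∫ z in (-Real.pi)..Real.pi, r * U (r, z)) 0 r := by
    intro r hr
    refine (hs.hasDerivAt_integral hr).congr_deriv ?_
    -- Incompressibility in the form ∂_r(rU) = -∂_z(rW); the right-hand side integrates to zero over
    -- a period.
    have h1 : ∀ z, dR (fun x => x.1 * U x) (r, z) = -r * dZ W (r, z) := by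
      intro z
      have h2 := (hs.hasDerivAt_r z hr).unique
        ((hasDerivAt_id r).mul (h.smooth_U.hasDerivAt_r z hr))
      have h3 := h.div_free r z hr
      simp only [id_eq] at h2
      linarith
    simp only [h1]
    rw [intervalIntegral.integral_const_mul, h.periodic_W.integral_dZ h.smooth_W hr, mul_zero]
  refine ⟨∫ z in (-Real.pi)..Real.pi, (r₀ + 1) * U (r₀ + 1, z), fun r hr => ?_⟩
  exact isOpen_Ioi.is_const_of_deriv_eq_zero (s := Ioi r₀) isPreconnected_Ioi
    (fun r hr => (hd r hr).differentiableAt.differentiableWithinAt)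
    (fun r hr => (hd r hr).deriv) hr (by simp : r₀ < r₀ + 1)

/-- The mean of U over a period is bounded because the flux of rU is constant and r ≥ 1; the
deviation from the mean is at most the total variation in z. -/
lemma abs_U_le (h : MeridionalFlow r₀ U W Om) :
    ∃ c, 0 ≤ c ∧ ∀ r, r₀ < r → 1 ≤ r → ∀ z ∈ Icc (-Real.pi) Real.pi,
      |U (r, z)| ≤ c + ∫ z in (-Real.pi)..Real.pi, |dZ U (r, z)| := by
  obtain ⟨c, hc⟩ := h.flux_const
  refine ⟨|c|, abs_nonneg c, fun r hr hr1 z hz => ?_⟩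
  have hc' := hc r hr
  rw [intervalIntegral.integral_const_mul] at hc'
  have h1 := two_pi_mul_le (fun z => h.smooth_U.hasDerivAt_z z hr)
    (h.smooth_U.dZ.continuousOn.slice_z hr) hz
  have h2 := two_pi_mul_le (fun z => (h.smooth_U.hasDerivAt_z z hr).neg)
    (h.smooth_U.dZ.continuousOn.slice_z hr).neg hz
  simp only [abs_neg, Pi.neg_apply, intervalIntegral.integral_neg] at h2
  set I := ∫ z in (-Real.pi)..Real.pi, U (r, z)
  set g := ∫ z in (-Real.pi)..Real.pi, |dZ U (r, z)|
  have h3 : |I| ≤ |c| := by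
    rw [← hc', abs_mul]
    have : 1 ≤ |r| := hr1.trans (le_abs_self r)
    nlinarith [abs_nonneg I]
  have h4 : 2 * Real.pi * |U (r, z)| ≤ |I| + 2 * Real.pi * g := by
    rcases abs_cases (U (r, z)) with ⟨e, -⟩ | ⟨e, -⟩ <;> rw [e] <;>
      linarith [le_abs_self I, neg_abs_le I]
  have hπ : 1 ≤ 2 * Real.pi := by linarith [Real.pi_gt_three]
  have h5 : |c| ≤ 2 * Real.pi * |c| := by nlinarith [abs_nonneg c]
  have h6 : 2 * Real.pi * |U (r, z)| ≤ 2 * Real.pi * (|c| + g) := by linarith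
  exact le_of_mul_le_mul_left h6 (by linarith)

/-- The radial energy flux through the cylinder of radius `r`. -/
noncomputable def energyFlux (U Om : ℝ × ℝ → ℝ) (r : ℝ) : ℝ :=
  ∫ z in (-Real.pi)..Real.pi,
    (r * (Om (r, z) * dR Om (r, z)) + Om (r, z) * Om (r, z)
      - r * (U (r, z) * (Om (r, z) * Om (r, z))) * (1 / 2))

/-- The energy dissipation on the cylinder of radius `r`. -/
noncomputable def dissipation (Om : ℝ × ℝ → ℝ) (r : ℝ) : ℝ :=
  ∫ z in (-Real.pi)..Real.pi, r * (dR Om (r, z) ^ 2 + dZ Om (r, z) ^ 2)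

/-- The mean square of `Om` on the cylinder of radius `r`. -/
noncomputable def sliceSq (Om : ℝ × ℝ → ℝ) (r : ℝ) : ℝ :=
  ∫ z in (-Real.pi)..Real.pi, Om (r, z) ^ 2

/-- Multiply the vorticity equation by rΩ. Since r(∂_r² + (3/r)∂_r)Ω = ∂_r(r∂_rΩ) + 2∂_rΩ and (rU,
rW) is divergence free, everything except r|∇Ω|² is a divergence. The summand Ω² of the flux comes
from 2Ω∂_rΩ. -/
lemma hasDerivAt_energyFlux (h : MeridionalFlow r₀ U W Om) {r : ℝ} (hr : r₀ < r) :
    HasDerivAt (energyFlux U Om) (dissipation Om r) r := by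
  have hO := h.smooth_Om
  have hr0 : r ≠ 0 := (h.nonneg.trans_lt hr).ne'
  have hfst := SmoothMer.fst r₀
  have hs1 : SmoothMer r₀ (fun x => x.1 * (Om x * dR Om x) + Om x * Om x
      - x.1 * (U x * (Om x * Om x)) * (1 / 2)) :=
    ((hfst.mul (hO.mul hO.dR)).add (hO.mul hO)).sub
      ((hfst.mul (h.smooth_U.mul (hO.mul hO))).mul (SmoothMer.const r₀ _))
  have hs2 : SmoothMer r₀ (fun x => x.1 * (Om x * dZ Om x)
      - x.1 * (W x * (Om x * Om x)) * (1 / 2)) :=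
    (hfst.mul (hO.mul hO.dZ)).sub
      ((hfst.mul (h.smooth_W.mul (hO.mul hO))).mul (SmoothMer.const r₀ _))
  have hp2 : PeriodicMer r₀ (fun x => x.1 * (Om x * dZ Om x)
      - x.1 * (W x * (Om x * Om x)) * (1 / 2)) := by
    intro r z hr
    simp only [h.periodic_Om r z hr, h.periodic_Om.dZ r z hr, h.periodic_W r z hr]
  refine (hs1.hasDerivAt_integral hr).congr_deriv ?_
  -- The z-component of the divergence is inserted as a zero: its integral over a period vanishes,
  -- and with it the identity holds pointwise.
  rw [← add_zero (∫ z in (-Real.pi)..Real.pi, dR _ (r, z)), ← hp2.integral_dZ hs2 hr,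
    ← intervalIntegral.integral_add ((hs1.dR.continuousOn.slice_z hr).intervalIntegrable _ _)
      ((hs2.dZ.continuousOn.slice_z hr).intervalIntegrable _ _), dissipation]
  refine intervalIntegral.integral_congr fun z _ => ?_
  have hOr := hO.hasDerivAt_r z hr
  have hOz := hO.hasDerivAt_z z hr
  have e1 := (hs1.hasDerivAt_r z hr).unique
    ((((hasDerivAt_id r).mul (hOr.mul (hO.dR.hasDerivAt_r z hr))).add (hOr.mul hOr)).sub
      (((hasDerivAt_id r).mul ((h.smooth_U.hasDerivAt_r z hr).mul (hOr.mul hOr))).mul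
        (hasDerivAt_const r (1 / 2 : ℝ))))
  have e2 := (hs2.hasDerivAt_z z hr).unique
    (((hasDerivAt_const z r).mul (hOz.mul (hO.dZ.hasDerivAt_z z hr))).sub
      (((hasDerivAt_const z r).mul ((h.smooth_W.hasDerivAt_z z hr).mul (hOz.mul hOz))).mul
        (hasDerivAt_const z (1 / 2 : ℝ))))
  have e3 := h.div_free r z hr
  have e4 : r * (U (r, z) * dR Om (r, z) + W (r, z) * dZ Om (r, z)) =
      r * dR (dR Om) (r, z) + 3 * dR Om (r, z) + r * dZ (dZ Om) (r, z) := by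
    rw [h.vorticity r z hr]
    field_simp
  simp only [Pi.mul_apply, id_eq] at e1 e2 ⊢
  rw [e1, e2]
  linear_combination (-Om (r, z) ^ 2 / 2) * e3 - Om (r, z) * e4

end MeridionalFlow

/-! ### Local energy estimate and the choice of good cylinders -/

namespace MeridionalFlow

variable {r₀ : ℝ} {U W Om : ℝ × ℝ → ℝ}

lemma continuousOn_sliceSq (hO : SmoothMer r₀ Om) : ContinuousOn (sliceSq Om) (Ioi r₀) :=
  ContinuousOn.integral_slice (F := fun x => Om x ^ 2) (hO.continuousOn.pow 2)

lemma continuousOn_dissipation (hO : SmoothMer r₀ Om) :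
    ContinuousOn (dissipation Om) (Ioi r₀) :=
  ContinuousOn.integral_slice (F := fun x => x.1 * (dR Om x ^ 2 + dZ Om x ^ 2))
    (continuousOn_fst.mul ((hO.dR.continuousOn.pow 2).add (hO.dZ.continuousOn.pow 2)))

lemma sliceSq_nonneg (Om : ℝ × ℝ → ℝ) (r : ℝ) : 0 ≤ sliceSq Om r :=
  intervalIntegral.integral_nonneg (by linarith [Real.pi_pos]) fun _ _ => sq_nonneg _

/-- Young's inequality, with x the value of a cutoff and y its slope: 2xy|Ω||∂_rΩ| ≤ x²|∂_rΩ|² +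
y²Ω². This is the hypothesis `hbound` of `cutoff_right` and `cutoff_left`. -/
lemma abs_energyFlux_le (h : MeridionalFlow r₀ U W Om) {r u A : ℝ} (hr : r₀ < r) (hrA : r ≤ A)
    (hu : ∀ z ∈ Icc (-Real.pi) Real.pi, |U (r, z)| ≤ u) {x y : ℝ} (hx : 0 ≤ x) (hy : 0 ≤ y) :
    2 * x * y * |energyFlux U Om r| ≤ x ^ 2 * dissipation Om r
      + (y ^ 2 * A + 2 * x * y * (1 + r * u)) * sliceSq Om r := by
  have hr0 : 0 < r := h.nonneg.trans_lt hr
  have hO := h.smooth_Om.continuousOn.slice_z hr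
  have hOr := h.smooth_Om.dR.continuousOn.slice_z hr
  have hOz := h.smooth_Om.dZ.continuousOn.slice_z hr
  have hU := h.smooth_U.continuousOn.slice_z hr
  have hπ : -Real.pi ≤ Real.pi := by linarith [Real.pi_pos]
  have hxy : 0 ≤ 2 * x * y := by positivity
  have h1 : |energyFlux U Om r| ≤ ∫ z in (-Real.pi)..Real.pi,
      |r * (Om (r, z) * dR Om (r, z)) + Om (r, z) * Om (r, z)
      - r * (U (r, z) * (Om (r, z) * Om (r, z))) * (1 / 2)| :=
    intervalIntegral.abs_integral_le_integral_abs hπ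
  refine (mul_le_mul_of_nonneg_left h1 hxy).trans ?_
  rw [dissipation, sliceSq, ← intervalIntegral.integral_const_mul,
    ← intervalIntegral.integral_const_mul, ← intervalIntegral.integral_const_mul,
    ← intervalIntegral.integral_add]
  rotate_left
  · exact (continuous_const.mul (continuous_const.mul ((hOr.pow 2).add (hOz.pow 2)))).intervalIntegrable _ _
  · exact (continuous_const.mul (hO.pow 2)).intervalIntegrable _ _
  refine intervalIntegral.integral_mono_on hπ ?_ ?_ fun z hz => ?_
  · exact (continuous_const.mul ((((continuous_const.mul (hO.mul hOr)).add (hO.mul hO)).sub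
      ((continuous_const.mul (hU.mul (hO.mul hO))).mul continuous_const)).abs)).intervalIntegrable
        _ _
  · exact ((continuous_const.mul (continuous_const.mul ((hOr.pow 2).add (hOz.pow 2)))).add
      (continuous_const.mul (hO.pow 2))).intervalIntegrable _ _
  set o := Om (r, z)
  set p := dR Om (r, z)
  have h2 : |r * (o * p) + o * o - r * (U (r, z) * (o * o)) * (1 / 2)|
      ≤ r * (|o| * |p|) + o ^ 2 + r * u * o ^ 2 := by
    have e1 : |r * (o * p)| = r * (|o| * |p|) := by rw [abs_mul, abs_mul, abs_of_pos hr0]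
    have e2 : |o * o| = o ^ 2 := by rw [← sq, abs_of_nonneg (sq_nonneg o)]
    have e3 : |r * (U (r, z) * (o * o)) * (1 / 2)| ≤ r * u * o ^ 2 := by
      rw [abs_mul, abs_mul, abs_mul, e2, abs_of_pos hr0, abs_of_pos (by norm_num : (0:ℝ) < 1 / 2)]
      have := mul_le_mul_of_nonneg_right (hu z hz) (mul_nonneg hr0.le (sq_nonneg o))
      have h0 : 0 ≤ |U (r, z)| * (r * o ^ 2) := by positivity
      linarith
    calc _ ≤ |r * (o * p)| + |o * o| + |r * (U (r, z) * (o * o)) * (1 / 2)| :=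
          (abs_sub _ _).trans (add_le_add_left (abs_add_le _ _) _)
      _ ≤ _ := by rw [e1, e2]; linarith
  have h3 : 2 * x * y * (r * (|o| * |p|)) ≤ x ^ 2 * (r * p ^ 2) + y ^ 2 * A * o ^ 2 := by
    have h4 : 0 ≤ r * (x * |p| - y * |o|) ^ 2 := by positivity
    have h5 : y ^ 2 * r * o ^ 2 ≤ y ^ 2 * A * o ^ 2 := by gcongr
    rw [← sq_abs o, ← sq_abs p] at *
    nlinarith
  have h6 : 0 ≤ x ^ 2 * (r * dZ Om (r, z) ^ 2) := by positivity
  have h7 := mul_le_mul_of_nonneg_left h2 hxy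
  nlinarith

/-- On dyadic annuli the dissipation is controlled by the mean square of `Om`, provided that the
integral of the radial velocity bound grows at most linearly. -/
lemma integral_dissipation_le (h : MeridionalFlow r₀ U W Om) {C R₁ : ℝ} (hC : 0 < C)
    (hg : ∀ R, R₁ ≤ R → ∫ r in R..2 * R,
      (1 + ∫ z in (-Real.pi)..Real.pi, |dZ U (r, z)|) ≤ C * R) :
    ∃ K R₂, 0 < K ∧ ∀ R, R₂ ≤ R →
      ∫ r in R..2 * R, dissipation Om r ≤ K * ∫ r in (R / 2)..(4 * R), sliceSq Om r := by
  obtain ⟨c, hc0, hc⟩ := h.abs_U_le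
  have hr₀ := h.nonneg
  -- The thresholds make the estimate `hg` available from R/2 onwards and give R/2 ≥ r₀ + 1, so that
  -- the enlarged annulus stays in the domain and in the range r ≥ 1 of `abs_U_le`.
  refine ⟨16 * C ^ 2 + 4 * C * (5 + 4 * c), max (2 * R₁) (2 * r₀ + 2), by positivity,
    fun R hR => ?_⟩
  have hR1 : 2 * R₁ ≤ R := (le_max_left _ _).trans hR
  have hR2 : 2 * r₀ + 2 ≤ R := (le_max_right _ _).trans hR
  set g : ℝ → ℝ := fun r => 1 + ∫ z in (-Real.pi)..Real.pi, |dZ U (r, z)| with hgdef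
  have hgc : ContinuousOn g (Ioi r₀) :=
    continuousOn_const.add (ContinuousOn.integral_slice h.smooth_U.dZ.continuousOn.abs)
  -- Freezing g below R/2 gives a continuous function on the whole line; its reciprocal is the slope
  -- of both cutoffs.
  set f : ℝ → ℝ := fun r => g (max (R / 2) r) with hfdef
  have hfc : Continuous f := hgc.comp_continuous (by fun_prop) fun r => by
    have : R / 2 ≤ max (R / 2) r := le_max_left _ _
    simp only [mem_Ioi]
    linarith
  have hg1 : ∀ r, 1 ≤ g r := fun r => by
    have : 0 ≤ ∫ z in (-Real.pi)..Real.pi, |dZ U (r, z)| :=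
      intervalIntegral.integral_nonneg (by linarith [Real.pi_pos]) fun _ _ => abs_nonneg _
    simp only [hgdef]
    linarith
  have hf1 : ∀ r, 1 ≤ f r := fun r => hg1 _
  have hfg : ∀ r, R / 2 ≤ r → f r = g r := fun r hr => by simp only [hfdef, max_eq_right hr]
  have hhc : Continuous fun r => (f r)⁻¹ := hfc.inv₀ fun r => by linarith [hf1 r]
  have hpos : ∀ a b : ℝ, R / 2 ≤ a → ∀ t ∈ Icc a b, r₀ < t := fun a b ha t ht => by
    linarith [ht.1]
  have hlow : ∀ a, R / 2 ≤ a → R / (2 * C) ≤ ∫ r in a..2 * a, (f r)⁻¹ := by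
    intro a ha
    have h1 : ∫ r in a..2 * a, f r ≤ C * (2 * a - a) := by
      rw [intervalIntegral.integral_congr (g := g)]
      · have := hg a (by linarith)
        linarith
      · intro r hr
        rw [uIcc_of_le (by linarith)] at hr
        exact hfg r (ha.trans hr.1)
    have h2 := le_integral_inv (by linarith) hfc (fun t => by linarith [hf1 t]) hC h1
    refine le_trans ?_ h2
    rw [div_le_div_iff₀ (by positivity) hC]
    nlinarith
  -- For t ≤ 4R and g ≥ 1, R ≥ 1, the quotient (1 + t(c + g))/g is at most 1 + 4Rc + 4R ≤ R(5 + 4c).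
  set M := R * (5 + 4 * c) with hM
  have hB : ∀ a, R / 2 ≤ a → ∀ b, b ≤ 4 * R → ∀ t ∈ Icc a b,
      (f t)⁻¹ * (1 + t * (c + g t)) ≤ M := by
    intro a ha b hb t ht
    rw [hfg t (ha.trans ht.1), inv_mul_le_iff₀ (by linarith [hg1 t])]
    have h1 : t ≤ 4 * R := ht.2.trans hb
    have h2 : 0 ≤ c + g t := by linarith [hg1 t]
    have h3 : t * (c + g t) ≤ 4 * R * (c + g t) := mul_le_mul_of_nonneg_right h1 h2
    have h4 : c ≤ g t * c := by nlinarith [hg1 t]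
    have h5 : 4 * R * c ≤ 4 * R * (g t * c) := by
      apply mul_le_mul_of_nonneg_left h4; linarith
    have h6 : 1 ≤ g t * R := by nlinarith [hg1 t]
    rw [hM]
    nlinarith
  have hbound : ∀ a, R / 2 ≤ a → ∀ b, b ≤ 4 * R → ∀ t ∈ Icc a b, ∀ x y : ℝ, 0 ≤ x → 0 ≤ y →
      2 * x * y * |energyFlux U Om t| ≤ x ^ 2 * dissipation Om t
        + (y ^ 2 * (4 * R) + 2 * x * y * (1 + t * (c + g t))) * sliceSq Om t := by
    intro a ha b hb t ht x y hx hy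
    have htr := hpos a b ha t ht
    refine h.abs_energyFlux_le htr (ht.2.trans hb) (fun z hz => ?_) hx hy
    refine (hc t htr (by linarith [ht.1]) z hz).trans ?_
    simp only [hgdef]
    linarith
  have hcontD : ∀ a b, R / 2 ≤ a → ContinuousOn (dissipation Om) (Icc a b) := fun a b ha =>
    (continuousOn_dissipation h.smooth_Om).mono (hpos a b ha)
  have hcontG : ∀ a b, R / 2 ≤ a → ContinuousOn (sliceSq Om) (Icc a b) := fun a b ha =>
    (continuousOn_sliceSq h.smooth_Om).mono (hpos a b ha)
  have hR0 : 0 < R := by linarith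
  have hM0 : 0 ≤ M := by positivity
  -- The dissipation over [R, 2R] is E(2R) - E(R). The inner annulus [R/2, R] bounds -E(R) and the
  -- outer annulus [2R, 4R] bounds E(2R).
  have hl := cutoff_left (a := R / 2) (b := R) (A := 4 * R) (M := M) (κ := R / (2 * C))
    (by linarith) (fun t ht => h.hasDerivAt_energyFlux (hpos _ _ le_rfl t ht))
    (hcontD _ _ le_rfl) (hcontG _ _ le_rfl) (fun t _ => sliceSq_nonneg _ _) hhc
    (fun t => inv_nonneg.2 (by linarith [hf1 t])) (fun t => inv_le_one_of_one_le₀ (hf1 t)) hM0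
    (by linarith) (hB _ le_rfl _ (by linarith)) (by positivity)
    (by simpa [mul_div_cancel₀] using hlow (R / 2) le_rfl) (hbound _ le_rfl _ (by linarith))
  have hr := cutoff_right (c := 2 * R) (d := 4 * R) (A := 4 * R) (M := M) (κ := R / (2 * C))
    (by linarith) (fun t ht => h.hasDerivAt_energyFlux (hpos (2 * R) _ (by linarith) t ht))
    (hcontD _ _ (by linarith)) (hcontG _ _ (by linarith)) (fun t _ => sliceSq_nonneg _ _) hhc
    (fun t => inv_nonneg.2 (by linarith [hf1 t])) (fun t => inv_le_one_of_one_le₀ (hf1 t)) hM0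
    (by linarith) (hB _ (by linarith) _ le_rfl) (by positivity)
    (by
      have := hlow (2 * R) (by linarith)
      rwa [show 2 * (2 * R) = 4 * R by ring] at this) (hbound _ (by linarith) _ le_rfl)
  have hFTC : ∫ r in R..2 * R, dissipation Om r = energyFlux U Om (2 * R) - energyFlux U Om R := by
    refine intervalIntegral.integral_eq_sub_of_hasDerivAt (fun t ht => ?_)
      ((hcontD _ _ (by linarith)).intervalIntegrable_of_Icc (by linarith))
    rw [uIcc_of_le (by linarith)] at ht
    exact h.hasDerivAt_energyFlux (hpos R _ (by linarith) t ht)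
  have hint : ∀ a b, R / 2 ≤ a → a ≤ b → IntervalIntegrable (sliceSq Om) volume a b :=
    fun a b ha hab => (hcontG a b ha).intervalIntegrable_of_Icc hab
  have hsum : (∫ r in (R / 2)..R, sliceSq Om r) + (∫ r in (2 * R)..(4 * R), sliceSq Om r)
      ≤ ∫ r in (R / 2)..(4 * R), sliceSq Om r := by
    have e1 := intervalIntegral.integral_add_adjacent_intervals (hint (R / 2) R le_rfl (by linarith))
      (hint R (4 * R) (by linarith) (by linarith))
    have e2 := intervalIntegral.integral_add_adjacent_intervals
      (hint R (2 * R) (by linarith) (by linarith))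
      (hint (2 * R) (4 * R) (by linarith) (by linarith))
    have : 0 ≤ ∫ r in R..2 * R, sliceSq Om r :=
      intervalIntegral.integral_nonneg (by linarith) fun _ _ => sliceSq_nonneg _ _
    linarith
  have hconst : 4 * R / (R / (2 * C)) ^ 2 + 2 * M / (R / (2 * C))
      ≤ 16 * C ^ 2 + 4 * C * (5 + 4 * c) := by
    have e : 4 * R / (R / (2 * C)) ^ 2 + 2 * M / (R / (2 * C))
        = 16 * C ^ 2 / R + 4 * C * (5 + 4 * c) := by
      rw [hM]
      field_simp
      ring
    rw [e]
    have : 16 * C ^ 2 / R ≤ 16 * C ^ 2 := div_le_self (by positivity) (by linarith)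
    linarith
  have hI : 0 ≤ (∫ r in (R / 2)..R, sliceSq Om r) + (∫ r in (2 * R)..(4 * R), sliceSq Om r) :=
    add_nonneg (intervalIntegral.integral_nonneg (by linarith) fun _ _ => sliceSq_nonneg _ _)
      (intervalIntegral.integral_nonneg (by linarith) fun _ _ => sliceSq_nonneg _ _)
  calc _ ≤ (4 * R / (R / (2 * C)) ^ 2 + 2 * M / (R / (2 * C))) *
      ((∫ r in (R / 2)..R, sliceSq Om r) + (∫ r in (2 * R)..(4 * R), sliceSq Om r)) := by
        rw [hFTC, mul_add]
        linarith
    _ ≤ _ := mul_le_mul hconst hsum hI (by positivity)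

/-- In every large dyadic annulus there is a cylinder on which `Om` is bounded by its quadratic
mean on a larger annulus. -/
lemma exists_good_radius (h : MeridionalFlow r₀ U W Om) {C R₁ : ℝ} (hC : 0 < C)
    (hg : ∀ R, R₁ ≤ R → ∫ r in R..2 * R,
      (1 + ∫ z in (-Real.pi)..Real.pi, |dZ U (r, z)|) ≤ C * R) :
    ∃ K R₂, 0 < K ∧ ∀ R, R₂ ≤ R → ∃ r ∈ Icc R (2 * R), ∀ z ∈ Icc (-Real.pi) Real.pi,
      Om (r, z) ^ 2 * R ≤ K * ∫ r in (R / 2)..(4 * R), sliceSq Om r := by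
  obtain ⟨K, R₂, hK, hR₂⟩ := h.integral_dissipation_le hC hg
  have hr₀ := h.nonneg
  have hO := h.smooth_Om
  refine ⟨2 * (1 + K), max R₂ (2 * r₀ + 2), by positivity, fun R hR => ?_⟩
  have hD := hR₂ R ((le_max_left _ _).trans hR)
  have hR2 : 2 * r₀ + 2 ≤ R := (le_max_right _ _).trans hR
  have hsub : Icc R (2 * R) ⊆ Ioi r₀ := fun t ht => by
    simp only [mem_Ioi]; linarith [ht.1]
  set Q : ℝ → ℝ := fun r => sliceSq Om r + dissipation Om r with hQ
  have hQc : ContinuousOn Q (Icc R (2 * R)) :=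
    ((continuousOn_sliceSq hO).add (continuousOn_dissipation hO)).mono hsub
  -- At a minimum point R·Q(r) is at most the integral of Q over [R, 2R], so one cylinder carries no
  -- more than the average of both the mean square and the dissipation.
  obtain ⟨r, hr, hmin⟩ := isCompact_Icc.exists_isMinOn (nonempty_Icc.2 (by linarith)) hQc
  refine ⟨r, hr, fun z hz => ?_⟩
  have hrr : r₀ < r := hsub hr
  have h1 : R * Q r ≤ ∫ t in R..2 * R, Q t := by
    have := intervalIntegral.integral_mono_on (a := R) (b := 2 * R) (f := fun _ => Q r) (g := Q)
      (μ := volume) (by linarith) (by simp) (hQc.intervalIntegrable_of_Icc (by linarith))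
      (fun t ht => hmin ht)
    simp only [intervalIntegral.integral_const, smul_eq_mul] at this
    linarith
  have hint : ∀ a b, R / 2 ≤ a → a ≤ b → IntervalIntegrable (sliceSq Om) volume a b :=
    fun a b ha hab => ((continuousOn_sliceSq hO).mono fun t ht => by
      simp only [mem_Ioi]; linarith [ht.1]).intervalIntegrable_of_Icc hab
  have h2 : ∫ t in R..2 * R, Q t ≤ (1 + K) * ∫ r in (R / 2)..(4 * R), sliceSq Om r := by
    rw [hQ, intervalIntegral.integral_add (hint _ _ (by linarith) (by linarith))
      (((continuousOn_dissipation hO).mono hsub).intervalIntegrable_of_Icc (by linarith))]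
    have : ∫ t in R..2 * R, sliceSq Om t ≤ ∫ r in (R / 2)..(4 * R), sliceSq Om r :=
      intervalIntegral.integral_mono_interval (by linarith) (by linarith) (by linarith)
        (by filter_upwards with t using sliceSq_nonneg _ _) (hint _ _ le_rfl (by linarith))
    linarith
  have hc1 := hO.continuousOn.slice_z hrr
  have hc2 := hO.dZ.continuousOn.slice_z hrr
  have hc3 := hO.dR.continuousOn.slice_z hrr
  have h3 := two_pi_mul_le (f := fun z => Om (r, z) ^ 2)
    (f' := fun z => 2 * Om (r, z) * dZ Om (r, z))
    (fun z => ((hO.hasDerivAt_z z hrr).pow 2).congr_deriv (by simp))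
    ((continuous_const.mul hc1).mul hc2) hz
  -- Arithmetic-geometric mean: 2|Ω∂_zΩ| ≤ Ω² + (∂_zΩ)², and the factor r ≥ 1 in the dissipation may
  -- be dropped.
  have h4 : ∫ s in (-Real.pi)..Real.pi, |2 * Om (r, s) * dZ Om (r, s)| ≤ Q r := by
    rw [hQ]
    simp only [sliceSq, dissipation]
    have hc4 : Continuous fun z => r * (dR Om (r, z) ^ 2 + dZ Om (r, z) ^ 2) :=
      continuous_const.mul ((hc3.pow 2).add (hc2.pow 2))
    have hc5 : Continuous fun z => Om (r, z) ^ 2 := hc1.pow 2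
    rw [← intervalIntegral.integral_add (hc5.intervalIntegrable _ _)
      (hc4.intervalIntegrable _ _)]
    refine intervalIntegral.integral_mono_on (by linarith [Real.pi_pos])
      (((continuous_const.mul hc1).mul hc2).abs.intervalIntegrable _ _)
      ((hc5.add hc4).intervalIntegrable _ _) fun s _ => ?_
    have hr1 : 1 ≤ r := by linarith [hr.1]
    have h5 : dZ Om (r, s) ^ 2 ≤ r * (dR Om (r, s) ^ 2 + dZ Om (r, s) ^ 2) := by
      nlinarith [sq_nonneg (dR Om (r, s)), sq_nonneg (dZ Om (r, s))]
    rw [abs_le]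
    constructor <;> nlinarith [sq_nonneg (Om (r, s) + dZ Om (r, s)),
      sq_nonneg (Om (r, s) - dZ Om (r, s))]
  have hD0 : 0 ≤ dissipation Om r :=
    intervalIntegral.integral_nonneg (by linarith [Real.pi_pos]) fun s _ => by
      have : 0 ≤ r := by linarith [hr.1]
      positivity
  have h6 : ∫ s in (-Real.pi)..Real.pi, Om (r, s) ^ 2 ≤ 2 * Real.pi * Q r := by
    have e : ∫ s in (-Real.pi)..Real.pi, Om (r, s) ^ 2 = sliceSq Om r := rfl
    rw [e, hQ]
    have := sliceSq_nonneg Om r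
    nlinarith [Real.pi_gt_three]
  have h7 : Om (r, z) ^ 2 ≤ 2 * Q r := by
    have : 2 * Real.pi * Om (r, z) ^ 2 ≤ 2 * Real.pi * (2 * Q r) := by
      have := mul_le_mul_of_nonneg_left h4 (by positivity : 0 ≤ 2 * Real.pi)
      linarith
    exact le_of_mul_le_mul_left this (by positivity)
  have hR0 : 0 ≤ R := by linarith
  nlinarith

end MeridionalFlow

/-! ### Maximum principle -/

/-- The second derivative is nonpositive at a local maximum. -/
lemma IsLocalMax.second_deriv_nonpos {f f' : ℝ → ℝ} {x c : ℝ} (hmax : IsLocalMax f x)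
    (hf : ∀ᶠ y in 𝓝 x, HasDerivAt f (f' y) y) (hf' : HasDerivAt f' c x) : c ≤ 0 := by
  by_contra! hc
  have h1 : deriv f =ᶠ[𝓝 x] f' := hf.mono fun y hy => hy.deriv
  -- If c > 0, the point is a local minimum as well, so f is locally constant and its second
  -- derivative vanishes.
  have h2 : deriv (deriv f) x = c := h1.deriv_eq.trans hf'.deriv
  have h3 : IsLocalMin f x := isLocalMin_of_deriv_deriv_pos (by rw [h2]; exact hc)
    hmax.deriv_eq_zero hf.self_of_nhds.continuousAt
  have h4 : f =ᶠ[𝓝 x] fun _ => f x := by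
    filter_upwards [hmax, h3] with y hy1 hy2
    exact le_antisymm hy1 hy2
  have h5 : deriv f =ᶠ[𝓝 x] fun _ => 0 := by
    simpa using h4.deriv
  have h6 := h5.deriv_eq
  rw [h2] at h6
  simp at h6
  exact hc.ne' h6

lemma PeriodicMer.exists_Icc {r₀ : ℝ} {F : ℝ × ℝ → ℝ} (hF : PeriodicMer r₀ F) {r : ℝ}
    (hr : r₀ < r) (z : ℝ) : ∃ w ∈ Icc (-Real.pi) Real.pi, F (r, z) = F (r, w) := by
  have hp : Function.Periodic (fun z => F (r, z)) (2 * Real.pi) := fun z => hF r z hr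
  obtain ⟨w, hw, h⟩ := hp.exists_mem_Ico (by positivity) z (-Real.pi)
  exact ⟨w, ⟨hw.1, by linarith [hw.2]⟩, h⟩

/-- The weak maximum principle on a periodic strip. -/
lemma periodic_le_of_boundary_le {r₀ a b m : ℝ} {F β γ : ℝ × ℝ → ℝ} (hF : PeriodicMer r₀ F)
    (hs : SmoothMer r₀ F) (ha : r₀ < a) (hβ : ContinuousOn β (meridian r₀))
    (heq : ∀ r z, r₀ < r → dR (dR F) (r, z) + dZ (dZ F) (r, z) + β (r, z) * dR F (r, z)
      + γ (r, z) * dZ F (r, z) = 0)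
    (hma : ∀ z ∈ Icc (-Real.pi) Real.pi, F (a, z) ≤ m)
    (hmb : ∀ z ∈ Icc (-Real.pi) Real.pi, F (b, z) ≤ m)
    {r z : ℝ} (hr : r ∈ Icc a b) (hz : z ∈ Icc (-Real.pi) Real.pi) : F (r, z) ≤ m := by
  set K := Icc a b ×ˢ Icc (-Real.pi) Real.pi
  have hK : IsCompact K := isCompact_Icc.prod isCompact_Icc
  have hKsub : K ⊆ meridian r₀ := fun x hx => ha.trans_le hx.1.1
  obtain ⟨C, hC⟩ := hK.exists_bound_of_continuousOn (hβ.mono hKsub)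
  have hrz : (r, z) ∈ K := ⟨hr, hz⟩
  have hC0 : 0 ≤ C := (norm_nonneg _).trans (hC _ hrz)
  set κ := C + 1
  refine le_of_forall_pos_le_add fun ε hε => ?_
  -- A small perturbation turning F into a strict subsolution: P'' + βP' ≥ κ(κ - C)P > 0 since κ = C
  -- + 1 exceeds the bound C for |β| on the strip, while 0 < P ≤ ε up to r = b.
  set P : ℝ → ℝ := fun s => ε * Real.exp (κ * (s - b)) with hP
  have hPd : ∀ s, HasDerivAt P (κ * P s) s := by
    intro s
    have h1 : HasDerivAt (fun s => κ * (s - b)) κ s := by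
      simpa using ((hasDerivAt_id s).sub_const b).const_mul κ
    exact (h1.exp.const_mul ε).congr_deriv (by simp only [hP]; ring)
  have hPpos : ∀ s, 0 < P s := fun s => by positivity
  have hPle : ∀ s ≤ b, P s ≤ ε := fun s hs => by
    have : Real.exp (κ * (s - b)) ≤ 1 :=
      Real.exp_le_one_iff.2 (mul_nonpos_of_nonneg_of_nonpos (by positivity) (by linarith))
    simp only [hP]
    nlinarith
  have hPc : Continuous P := continuous_iff_continuousAt.2 fun s => (hPd s).continuousAt
  obtain ⟨⟨s, w⟩, hsw, hmax⟩ := hK.exists_isMaxOn ⟨_, hrz⟩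
    ((hs.continuousOn.mono hKsub).add (hPc.comp_continuousOn continuousOn_fst))
  have hle : F (r, z) + P r ≤ F (s, w) + P s := hmax hrz
  have hsI : s ∈ Icc a b := hsw.1
  have hwI : w ∈ Icc (-Real.pi) Real.pi := hsw.2
  have hfin : F (s, w) ≤ m → F (r, z) ≤ m + ε := fun h => by
    linarith [hPpos r, hPle s hsI.2]
  rcases hsI.1.eq_or_lt with h1 | h1
  · exact hfin (h1 ▸ hma w hwI)
  rcases hsI.2.eq_or_lt with h2 | h2
  · exact hfin (h2 ▸ hmb w hwI)
  exfalso
  have hsr : r₀ < s := ha.trans h1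
  have hmaxr : IsLocalMax (fun t => F (t, w) + P t) s := by
    filter_upwards [Ioo_mem_nhds h1 h2] with t ht
    exact hmax (show (t, w) ∈ K from ⟨⟨ht.1.le, ht.2.le⟩, hwI⟩)
  -- By periodicity the maximum over one period is global in z, so z = ±π needs no separate
  -- treatment. The vanishing of ∂_zF there removes γ, about which nothing is assumed.
  have hmaxz : IsLocalMax (fun t => F (s, t)) w := by
    filter_upwards with t
    obtain ⟨t', ht', e⟩ := hF.exists_Icc hsr t
    have : F (s, t') + P s ≤ F (s, w) + P s := hmax (show (s, t') ∈ K from ⟨hsI, ht'⟩)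
    rw [e]
    linarith
  have hdr : ∀ᶠ t in 𝓝 s, HasDerivAt (fun t => F (t, w) + P t) (dR F (t, w) + κ * P t) t := by
    filter_upwards [Ioi_mem_nhds hsr] with t ht
    exact (hs.hasDerivAt_r w ht).add (hPd t)
  have e1 := hmaxr.hasDerivAt_eq_zero hdr.self_of_nhds
  have e2 := hmaxr.second_deriv_nonpos hdr
    ((hs.dR.hasDerivAt_r w hsr).add ((hPd s).const_mul κ))
  have e3 := hmaxz.hasDerivAt_eq_zero (hs.hasDerivAt_z w hsr)
  have e4 := hmaxz.second_deriv_nonpos (.of_forall fun t => hs.hasDerivAt_z t hsr)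
    (hs.dZ.hasDerivAt_z w hsr)
  have e5 := heq s w hsr
  have e6 : |β (s, w)| ≤ C := hC _ hsw
  rw [e3, mul_zero, add_zero, show dR F (s, w) = -(κ * P s) by linarith] at e5
  have hκ : 0 < κ := by positivity
  have hp : 0 < κ * P s := mul_pos hκ (hPpos s)
  have e7 : -β (s, w) * (κ * P s) ≤ C * (κ * P s) :=
    mul_le_mul_of_nonneg_right ((neg_le_abs _).trans e6) hp.le
  have e8 : κ * (κ * P s) = C * (κ * P s) + κ * P s := by simp only [κ]; ring
  linarith

namespace MeridionalFlow

variable {r₀ : ℝ} {U W Om : ℝ × ℝ → ℝ}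

/-- The maximum principle for `Om`. -/
lemma abs_le_of_boundary_le (h : MeridionalFlow r₀ U W Om) {a b m : ℝ} (ha : r₀ < a)
    (hma : ∀ z ∈ Icc (-Real.pi) Real.pi, |Om (a, z)| ≤ m)
    (hmb : ∀ z ∈ Icc (-Real.pi) Real.pi, |Om (b, z)| ≤ m)
    {r z : ℝ} (hr : r ∈ Icc a b) (hz : z ∈ Icc (-Real.pi) Real.pi) : |Om (r, z)| ≤ m := by
  have hβ : ContinuousOn (fun x => 3 / x.1 - U x) (meridian r₀) :=
    ((SmoothMer.const r₀ 3).div_fst h.nonneg |>.sub h.smooth_U).continuousOn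
  have hneg : ∀ (G : ℝ × ℝ → ℝ), dR (fun x => -G x) = (fun x => -dR G x) ∧
      dZ (fun x => -G x) = (fun x => -dZ G x) := by
    intro G
    have : (fun x => -G x) = -G := rfl
    constructor <;> ext x <;> simp [dR, dZ, this, fderiv_neg]
  rw [abs_le']
  constructor
  · refine periodic_le_of_boundary_le h.periodic_Om h.smooth_Om ha hβ (γ := fun x => -W x)
      (fun r z hr => ?_) (fun z hz => (le_abs_self _).trans (hma z hz))
      (fun z hz => (le_abs_self _).trans (hmb z hz)) hr hz
    have := h.vorticity r z hr
    simp only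
    linarith
  · refine periodic_le_of_boundary_le (F := fun x => -Om x) (β := fun x => 3 / x.1 - U x)
      (γ := fun x => -W x) (fun r z hr => by simp only [h.periodic_Om r z hr])
      (ContDiffOn.neg h.smooth_Om) ha hβ
      (fun r z hr => ?_) (fun z hz => (neg_le_abs _).trans (hma z hz))
      (fun z hz => (neg_le_abs _).trans (hmb z hz)) hr hz
    have := h.vorticity r z hr
    simp only [hneg]
    linarith

/-! ### From integrability to pointwise decay -/

/-- The inequality x ≤ 1 + x^q and the weight r ≥ 1 bound the integral over [R, 2R] by a multiple of
R plus the finite total integral. This is the averaged velocity control required by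
`integral_dissipation_le`. -/
lemma exists_linear_bound (h : MeridionalFlow r₀ U W Om) {q r₁ : ℝ} (hq : 1 ≤ q) (hr₁ : r₀ ≤ r₁)
    (hU : IntegrableOn (fun r => r * ∫ z in (-Real.pi)..Real.pi, |dZ U (r, z)| ^ q) (Ioi r₁)) :
    ∃ C R₁, 0 < C ∧ ∀ R, R₁ ≤ R → ∫ r in R..2 * R,
      (1 + ∫ z in (-Real.pi)..Real.pi, |dZ U (r, z)|) ≤ C * R := by
  have hr₀ := h.nonneg
  have hπ := Real.pi_pos
  set P : ℝ → ℝ := fun r => r * ∫ z in (-Real.pi)..Real.pi, |dZ U (r, z)| ^ q with hP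
  have hcU := h.smooth_U.dZ.continuousOn
  have hin0 : ∀ r, 0 ≤ ∫ z in (-Real.pi)..Real.pi, |dZ U (r, z)| ^ q := fun r =>
    intervalIntegral.integral_nonneg (by linarith) fun _ _ => by positivity
  have hP0 : ∀ r ∈ Ioi r₁, 0 ≤ P r := fun r hr =>
    mul_nonneg (hr₀.trans (hr₁.trans (le_of_lt hr))) (hin0 r)
  set I := ∫ r in Ioi r₁, P r
  have hI : 0 ≤ I := setIntegral_nonneg measurableSet_Ioi hP0
  refine ⟨1 + 2 * Real.pi + I, r₁ + 1, by positivity, fun R hR => ?_⟩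
  have hR0 : 1 ≤ R := by linarith
  have hsub : Icc R (2 * R) ⊆ Ioi r₀ := fun t ht => by
    simp only [mem_Ioi]; linarith [ht.1]
  have hg : ContinuousOn (fun r => 1 + ∫ z in (-Real.pi)..Real.pi, |dZ U (r, z)|) (Icc R (2 * R)) :=
    continuousOn_const.add ((ContinuousOn.integral_slice hcU.abs).mono hsub)
  have hPI : IntervalIntegrable P volume R (2 * R) := by
    rw [intervalIntegrable_iff_integrableOn_Ioc_of_le (by linarith)]
    exact hU.mono_set fun t ht => by simp only [mem_Ioi]; linarith [ht.1]
  have h1 : ∫ r in R..2 * R, (1 + ∫ z in (-Real.pi)..Real.pi, |dZ U (r, z)|)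
      ≤ ∫ r in R..2 * R, (1 + 2 * Real.pi + P r) := by
    refine intervalIntegral.integral_mono_on (by linarith)
      (hg.intervalIntegrable_of_Icc (by linarith)) (intervalIntegrable_const.add hPI)
      fun r hr => ?_
    have hc := hcU.slice_z (hsub hr)
    have hcq : Continuous fun z => |dZ U (r, z)| ^ q :=
      hc.abs.rpow_const fun _ => Or.inr (by linarith)
    have h2 : ∫ z in (-Real.pi)..Real.pi, |dZ U (r, z)|
        ≤ ∫ z in (-Real.pi)..Real.pi, (1 + |dZ U (r, z)| ^ q) := by
      refine intervalIntegral.integral_mono_on (by linarith) (hc.abs.intervalIntegrable _ _)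
        ((continuous_const.add hcq).intervalIntegrable _ _) fun z _ => ?_
      rcases le_total (|dZ U (r, z)|) 1 with h3 | h3
      · have : 0 ≤ |dZ U (r, z)| ^ q := by positivity
        linarith
      · have := Real.self_le_rpow_of_one_le h3 hq
        linarith
    rw [intervalIntegral.integral_add (by simp) (hcq.intervalIntegrable _ _)] at h2
    simp only [intervalIntegral.integral_const, smul_eq_mul] at h2
    have h4 : (∫ z in (-Real.pi)..Real.pi, |dZ U (r, z)| ^ q) ≤ P r :=
      le_mul_of_one_le_left (hin0 r) (hR0.trans hr.1)
    linarith
  have h5 : ∫ r in R..2 * R, P r ≤ I := by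
    rw [intervalIntegral.integral_of_le (by linarith)]
    have hss : Ioc R (2 * R) ⊆ Ioi r₁ := fun t ht => by simp only [mem_Ioi]; linarith [ht.1]
    refine setIntegral_mono_set hU ?_ hss.eventuallyLE
    filter_upwards [ae_restrict_mem measurableSet_Ioi] with r hr using hP0 r hr
  rw [intervalIntegral.integral_add intervalIntegrable_const hPI] at h1
  simp only [intervalIntegral.integral_const, smul_eq_mul] at h1
  nlinarith

/-- The inequality x² ≤ 1 + x^q with x = |Ω|/l, at a level l left free. The powers of r are arranged
so that the integrable density r∫|rΩ|^q dz appears. -/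
lemma sliceSq_le (h : MeridionalFlow r₀ U W Om) {q r l : ℝ} (hq : 2 ≤ q) (hr : r₀ < r)
    (hl : 0 < l) : sliceSq Om r ≤ l ^ 2 * (2 * Real.pi + l ^ (-q) * r ^ (-q - 1) *
      (r * ∫ z in (-Real.pi)..Real.pi, |r * Om (r, z)| ^ q)) := by
  have hr0 : 0 < r := h.nonneg.trans_lt hr
  have hc := h.smooth_Om.continuousOn.slice_z hr
  have hcq : Continuous fun z => |r * Om (r, z)| ^ q :=
    (continuous_const.mul hc).abs.rpow_const fun _ => Or.inr (by linarith)
  have hpt : ∀ z, Om (r, z) ^ 2 ≤ l ^ 2 * (1 + l ^ (-q) * r ^ (-q) * |r * Om (r, z)| ^ q) := by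
    intro z
    have h1 : l ^ (-q) * r ^ (-q) * |r * Om (r, z)| ^ q = (|Om (r, z)| / l) ^ q := by
      rw [abs_mul, abs_of_pos hr0, Real.mul_rpow hr0.le (abs_nonneg _),
        Real.div_rpow (abs_nonneg _) hl.le, Real.rpow_neg hl.le, Real.rpow_neg hr0.le]
      have := (Real.rpow_pos_of_pos hr0 q).ne'
      field_simp
    rw [h1]
    set x := |Om (r, z)| / l
    have hx : 0 ≤ x := by positivity
    have h2 : Om (r, z) ^ 2 = l ^ 2 * x ^ 2 := by
      simp only [x]
      rw [div_pow, sq_abs]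
      field_simp
    rw [h2]
    refine mul_le_mul_of_nonneg_left ?_ (sq_nonneg l)
    have hxq : 0 ≤ x ^ q := by positivity
    rcases le_total x 1 with h3 | h3
    · nlinarith
    · have := Real.rpow_le_rpow_of_exponent_le h3 hq
      rw [Real.rpow_two] at this
      linarith
  have h1 : sliceSq Om r ≤ ∫ z in (-Real.pi)..Real.pi,
      l ^ 2 * (1 + l ^ (-q) * r ^ (-q) * |r * Om (r, z)| ^ q) :=
    intervalIntegral.integral_mono_on (by linarith [Real.pi_pos])
      ((hc.pow 2).intervalIntegrable _ _)
      ((continuous_const.mul (continuous_const.add (continuous_const.mul hcq))).intervalIntegrable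
        _ _) fun z _ => hpt z
  refine h1.trans_eq ?_
  have hcq' : Continuous fun z => l ^ (-q) * r ^ (-q) * |r * Om (r, z)| ^ q :=
    continuous_const.mul hcq
  rw [intervalIntegral.integral_const_mul, intervalIntegral.integral_add (by simp)
    (hcq'.intervalIntegrable _ _), intervalIntegral.integral_const_mul]
  simp only [intervalIntegral.integral_const, smul_eq_mul]
  rw [Real.rpow_sub_one hr0.ne']
  field_simp
  ring

end MeridionalFlow

lemma MeasureTheory.IntegrableOn.eventually_tail_le {P : ℝ → ℝ} {r₁ δ : ℝ}
    (hP : IntegrableOn P (Ioi r₁)) (hδ : 0 < δ) :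
    ∀ᶠ R in atTop, ∫ r in (R / 2)..(4 * R), P r ≤ δ := by
  have h1 := intervalIntegral_tendsto_integral_Ioi r₁ hP
    (tendsto_id.const_mul_atTop (by norm_num : (0 : ℝ) < 4))
  have h2 := intervalIntegral_tendsto_integral_Ioi r₁ hP
    (tendsto_id.atTop_div_const (by norm_num : (0 : ℝ) < 2))
  have h3 := h1.sub h2
  rw [sub_self] at h3
  filter_upwards [h3.eventually_le_const hδ, eventually_ge_atTop (2 * r₁),
    eventually_ge_atTop 0] with R hR hR1 hR0
  have hint : ∀ b, r₁ ≤ b → IntervalIntegrable P volume r₁ b := fun b hb => by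
    rw [intervalIntegrable_iff_integrableOn_Ioc_of_le hb]
    exact hP.mono_set fun t ht => ht.1
  rwa [intervalIntegral.integral_interval_sub_left (hint _ (by simp only [id]; linarith))
    (hint _ (by simp only [id]; linarith))] at hR

namespace MeridionalFlow

variable {r₀ : ℝ} {U W Om : ℝ × ℝ → ℝ}

/-- The exponent is dictated by scaling: on a dyadic annulus the density has total size
R^{q+2}|Ω|^q, and this tends to zero. The level l is therefore taken as a small multiple of
R^{-(1+2/q)}. -/
lemma eventually_exists_radius (h : MeridionalFlow r₀ U W Om) {q r₁ : ℝ} (hq : 2 ≤ q)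
    (hr₁ : r₀ ≤ r₁)
    (hU : IntegrableOn (fun r => r * ∫ z in (-Real.pi)..Real.pi, |dZ U (r, z)| ^ q) (Ioi r₁))
    (hO : IntegrableOn (fun r => r * ∫ z in (-Real.pi)..Real.pi, |r * Om (r, z)| ^ q) (Ioi r₁))
    {ε : ℝ} (hε : 0 < ε) :
    ∀ᶠ R in atTop, ∃ r ∈ Icc R (2 * R), ∀ z ∈ Icc (-Real.pi) Real.pi,
      |Om (r, z)| ≤ ε * R ^ (-(1 + 2 / q)) := by
  have hπ := Real.pi_pos
  have hr₀ := h.nonneg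
  obtain ⟨C, R₁, hC, hlin⟩ := h.exists_linear_bound (by linarith : 1 ≤ q) hr₁ hU
  obtain ⟨K, R₂, hK, hgood⟩ := h.exists_good_radius hC hlin
  -- The constant part of `sliceSq_le` integrates to 7πR ≤ 8πR over [R/2, 4R], and the remaining
  -- part is made at most R. Then e is chosen with e²L = ε².
  set L := K * (8 * Real.pi + 1) with hL
  have hL0 : 0 < L := by positivity
  set e := ε / √L with he
  have he0 : 0 < e := by positivity
  have heL : e ^ 2 * L = ε ^ 2 := by
    rw [he, div_pow, Real.sq_sqrt hL0.le]
    field_simp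
  -- Chosen so that l^{-q}(R/2)^{-q-1}δ is exactly R.
  set δ := e ^ q * (1 / 2) ^ (q + 1) with hδdef
  have hδ : 0 < δ := by positivity
  filter_upwards [hO.eventually_tail_le hδ, eventually_ge_atTop R₂,
    eventually_ge_atTop (2 * r₁ + 2)] with R htail hR2 hRr
  obtain ⟨r, hr, hbd⟩ := hgood R hR2
  refine ⟨r, hr, fun z hz => ?_⟩
  have hR0 : 0 < R := by linarith
  set P : ℝ → ℝ := fun r => r * ∫ z in (-Real.pi)..Real.pi, |r * Om (r, z)| ^ q
  set l := e * R ^ (-(1 + 2 / q)) with hl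
  have hl0 : 0 < l := by positivity
  have hP0 : ∀ t, 0 ≤ t → 0 ≤ P t := fun t ht =>
    mul_nonneg ht (intervalIntegral.integral_nonneg (by linarith) fun _ _ => by positivity)
  have hPint : IntervalIntegrable P volume (R / 2) (4 * R) := by
    rw [intervalIntegrable_iff_integrableOn_Ioc_of_le (by linarith)]
    exact hO.mono_set fun t ht => by simp only [mem_Ioi]; linarith [ht.1]
  have h1 : ∫ t in (R / 2)..(4 * R), sliceSq Om t ≤ ∫ t in (R / 2)..(4 * R),
      l ^ 2 * (2 * Real.pi + l ^ (-q) * (R / 2) ^ (-q - 1) * P t) := by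
    refine intervalIntegral.integral_mono_on (by linarith)
      (((continuousOn_sliceSq h.smooth_Om).mono fun t ht => ?_).intervalIntegrable_of_Icc
        (by linarith)) ((intervalIntegrable_const.add (hPint.const_mul _)).const_mul _)
      fun t ht => ?_
    · simp only [mem_Ioi]; linarith [ht.1]
    · refine (h.sliceSq_le hq (by linarith [ht.1]) hl0).trans ?_
      have h2 : t ^ (-q - 1) ≤ (R / 2) ^ (-q - 1) :=
        Real.rpow_le_rpow_of_nonpos (by linarith) ht.1 (by linarith)
      have h3 := hP0 t (by linarith [ht.1])
      have h4 : 0 ≤ l ^ (-q) := by positivity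
      gcongr
  have hq0 : q ≠ 0 := by linarith
  have h5 : l ^ (-q) * (R / 2) ^ (-q - 1) * δ = R := by
    have e1 : l ^ (-q) = (e ^ q)⁻¹ * R ^ (q + 2) := by
      rw [hl, Real.mul_rpow he0.le (by positivity), Real.rpow_neg he0.le, ← Real.rpow_mul hR0.le]
      congr 2
      field_simp
    have e2 : (R / 2) ^ (-q - 1) = R ^ (-q - 1) * (2 : ℝ) ^ (q + 1) := by
      rw [Real.div_rpow hR0.le (by norm_num), show -q - 1 = -(q + 1) by ring,
        Real.rpow_neg zero_le_two, div_inv_eq_mul]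
    have e3 : R ^ (q + 2) * R ^ (-q - 1) = R := by
      rw [← Real.rpow_add hR0]
      ring_nf
      exact Real.rpow_one R
    have e4 : (2 : ℝ) ^ (q + 1) * (1 / 2) ^ (q + 1) = 1 := by
      rw [← Real.mul_rpow (by norm_num) (by norm_num)]
      norm_num
    have e5 : (e ^ q)⁻¹ * e ^ q = 1 := inv_mul_cancel₀ (by positivity)
    rw [e1, e2, hδdef]
    calc _ = ((e ^ q)⁻¹ * e ^ q) * (R ^ (q + 2) * R ^ (-q - 1)) *
        ((2 : ℝ) ^ (q + 1) * (1 / 2) ^ (q + 1)) := by ring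
      _ = R := by rw [e3, e4, e5]; ring
  have h6 : ∫ t in (R / 2)..(4 * R), sliceSq Om t ≤ l ^ 2 * ((8 * Real.pi + 1) * R) := by
    refine h1.trans ?_
    rw [intervalIntegral.integral_const_mul, intervalIntegral.integral_add intervalIntegrable_const
      (hPint.const_mul _)]
    simp only [intervalIntegral.integral_const, smul_eq_mul, intervalIntegral.integral_const_mul]
    refine mul_le_mul_of_nonneg_left ?_ (sq_nonneg l)
    have h7 : l ^ (-q) * (R / 2) ^ (-q - 1) * ∫ t in (R / 2)..(4 * R), P t ≤ R := by
      exact (mul_le_mul_of_nonneg_left htail (by positivity)).trans_eq h5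
    nlinarith
  have h8 := (hbd z hz).trans (mul_le_mul_of_nonneg_left h6 hK.le)
  have h9 : Om (r, z) ^ 2 ≤ (ε * R ^ (-(1 + 2 / q))) ^ 2 := by
    refine le_of_mul_le_mul_right (h8.trans_eq ?_) hR0
    rw [mul_pow ε, ← heL, hl, hL]
    ring
  exact abs_le_of_sq_le_sq h9 (by positivity)

/-- The decay of `Om` at infinity. -/
theorem eventually_decay (h : MeridionalFlow r₀ U W Om) {q r₁ : ℝ} (hq : 2 ≤ q) (hr₁ : r₀ ≤ r₁)
    (hU : IntegrableOn (fun r => r * ∫ z in (-Real.pi)..Real.pi, |dZ U (r, z)| ^ q) (Ioi r₁))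
    (hO : IntegrableOn (fun r => r * ∫ z in (-Real.pi)..Real.pi, |r * Om (r, z)| ^ q) (Ioi r₁))
    {ε : ℝ} (hε : 0 < ε) :
    ∀ᶠ r in atTop, ∀ z ∈ Icc (-Real.pi) Real.pi, |Om (r, z)| ≤ ε * r ^ (-(1 + 2 / q)) := by
  set s := -(1 + 2 / q) with hs
  have hs0 : s ≤ 0 := by
    have : 0 ≤ 2 / q := by positivity
    linarith
  have hr₀ := h.nonneg
  have hc : 0 < (2 : ℝ) ^ s := by positivity
  -- Good cylinders are taken at the scales r and r/2, so that r lies between them. The factor 2^s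
  -- compensates (r/2)^s = 2^{-s}r^s on the inner one.
  have key := h.eventually_exists_radius hq hr₁ hU hO (mul_pos hε hc)
  have key2 := (tendsto_id.atTop_div_const (by norm_num : (0 : ℝ) < 2)).eventually key
  filter_upwards [key, key2, eventually_ge_atTop (2 * r₀ + 2)] with r ⟨b, hb, hbb⟩ ⟨a, ha, haa⟩ hr z hz
  simp only [id] at ha haa
  have hr0 : 0 < r := by linarith
  have h2 : (1 / 2 : ℝ) ^ s * 2 ^ s = 1 := by
    rw [← Real.mul_rpow (by norm_num) (by norm_num)]
    norm_num
  have h1 : ε * 2 ^ s * (r / 2) ^ s = ε * r ^ s := by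
    rw [show r / 2 = r * (1 / 2) by ring, Real.mul_rpow hr0.le (by norm_num)]
    linear_combination ε * r ^ s * h2
  have h3 : ε * 2 ^ s * r ^ s ≤ ε * r ^ s := by
    have : (2 : ℝ) ^ s ≤ 1 := Real.rpow_le_one_of_one_le_of_nonpos (by norm_num) hs0
    have h4 : 0 ≤ ε * r ^ s := by positivity
    nlinarith
  exact h.abs_le_of_boundary_le (a := a) (b := b) (by linarith [ha.1])
    (fun z hz => (haa z hz).trans_eq h1) (fun z hz => (hbb z hz).trans h3)
    ⟨by linarith [ha.2], hb.1⟩ hz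

end MeridionalFlow

/-! ### Cylindrical coordinates and first derivatives of the velocity -/

lemma cylRadius_cylPoint {r : ℝ} (hr : 0 ≤ r) (θ z : ℝ) : cylRadius (cylPoint r θ z) = r := by
  have : (r * Real.cos θ) ^ 2 + (r * Real.sin θ) ^ 2 = r ^ 2 := by
    linear_combination r ^ 2 * Real.sin_sq_add_cos_sq θ
  simp [cylRadius, cylPoint, this, Real.sqrt_sq hr]

@[simp] lemma cylPoint_zero (r θ z : ℝ) : cylPoint r θ z 0 = r * Real.cos θ := rfl
@[simp] lemma cylPoint_one (r θ z : ℝ) : cylPoint r θ z 1 = r * Real.sin θ := rfl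
@[simp] lemma cylPoint_two (r θ z : ℝ) : cylPoint r θ z 2 = z := rfl

lemma cylPoint_mem {r₀ r : ℝ} (hr₀ : 0 ≤ r₀) (hr : r₀ < r) (θ z : ℝ) :
    cylPoint r θ z ∈ cylExterior r₀ := by
  rw [cylExterior, mem_ofPred_eq, cylRadius_cylPoint (hr₀.trans hr.le)]
  exact hr

lemma continuous_cylRadius : Continuous cylRadius := by
  unfold cylRadius
  fun_prop

lemma isOpen_cylExterior (r₀ : ℝ) : IsOpen (cylExterior r₀) :=
  isOpen_lt continuous_const continuous_cylRadius

lemma cylRadius_sq (x : E3) : cylRadius x ^ 2 = x 0 ^ 2 + x 1 ^ 2 :=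
  Real.sq_sqrt (by positivity)

lemma hasDerivAt_euclidean {f : ℝ → E3} {f' : E3} {t : ℝ} :
    HasDerivAt f f' t ↔ ∀ i, HasDerivAt (fun s => f s i) (f' i) t := by
  simp only [hasDerivAt_iff_hasFDerivAt]
  rw [hasFDerivWithinAt_univ.symm, hasFDerivWithinAt_euclidean]
  simp only [hasFDerivWithinAt_univ]
  refine forall_congr' fun i => ?_
  have : PiLp.proj 2 (fun _ => ℝ) i ∘L ContinuousLinearMap.toSpanSingleton ℝ f'
      = ContinuousLinearMap.toSpanSingleton ℝ (f' i) := by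
    ext
    simp
  rw [← this]

lemma hasDerivAt_cylPoint_r (r θ z : ℝ) :
    HasDerivAt (fun s => cylPoint s θ z) (!₂[Real.cos θ, Real.sin θ, 0]) r := by
  rw [hasDerivAt_euclidean]
  intro i
  fin_cases i
  · simpa using (hasDerivAt_id r).mul_const (Real.cos θ)
  · simpa using (hasDerivAt_id r).mul_const (Real.sin θ)
  · simpa using hasDerivAt_const r z

lemma hasDerivAt_cylPoint_z (r θ z : ℝ) :
    HasDerivAt (fun s => cylPoint r θ s) (!₂[0, 0, 1]) z := by
  rw [hasDerivAt_euclidean]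
  intro i
  fin_cases i
  · simpa using hasDerivAt_const z _
  · simpa using hasDerivAt_const z _
  · exact hasDerivAt_id z

lemma hasDerivAt_cylPoint_θ (r θ z : ℝ) :
    HasDerivAt (fun s => cylPoint r s z) (!₂[-(r * Real.sin θ), r * Real.cos θ, 0]) θ := by
  rw [hasDerivAt_euclidean]
  intro i
  fin_cases i
  · simpa using (Real.hasDerivAt_cos θ).const_mul r
  · simpa using (Real.hasDerivAt_sin θ).const_mul r
  · simpa using hasDerivAt_const θ z

lemma contDiff_cylPoint (θ : ℝ) : ContDiff ℝ ∞ fun x : ℝ × ℝ => cylPoint x.1 θ x.2 := by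
  rw [contDiff_euclidean]
  intro i
  fin_cases i
  · simpa using contDiff_fst.mul contDiff_const
  · simpa using contDiff_fst.mul contDiff_const
  · simpa using contDiff_snd

/-- The radial velocity in the half plane `θ = 0`. -/
noncomputable def merU (v : E3 → E3) (x : ℝ × ℝ) : ℝ := v (cylPoint x.1 0 x.2) 0

/-- The axial velocity in the half plane `θ = 0`. -/
noncomputable def merW (v : E3 → E3) (x : ℝ × ℝ) : ℝ := v (cylPoint x.1 0 x.2) 2

/-- The restriction of a scalar function to the half plane `θ = 0`. -/
noncomputable def merP (p : E3 → ℝ) (x : ℝ × ℝ) : ℝ := p (cylPoint x.1 0 x.2)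

/-- The angular vorticity in terms of the meridional velocity. -/
noncomputable def merVort (v : E3 → E3) (x : ℝ × ℝ) : ℝ := dZ (merU v) x - dR (merW v) x

section Pointwise

variable {r₀ : ℝ} {v : E3 → E3} {p : E3 → ℝ}

lemma merU_smooth (hr₀ : 0 ≤ r₀) (hv : ContDiffOn ℝ ∞ v (cylExterior r₀)) :
    SmoothMer r₀ (merU v) := by
  have h1 : ContDiffOn ℝ ∞ (fun x : ℝ × ℝ => v (cylPoint x.1 0 x.2)) (meridian r₀) :=
    hv.comp (contDiff_cylPoint 0).contDiffOn fun x hx => cylPoint_mem hr₀ hx _ _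
  exact (contDiffOn_euclidean.1 h1) 0

lemma merW_smooth (hr₀ : 0 ≤ r₀) (hv : ContDiffOn ℝ ∞ v (cylExterior r₀)) :
    SmoothMer r₀ (merW v) := by
  have h1 : ContDiffOn ℝ ∞ (fun x : ℝ × ℝ => v (cylPoint x.1 0 x.2)) (meridian r₀) :=
    hv.comp (contDiff_cylPoint 0).contDiffOn fun x hx => cylPoint_mem hr₀ hx _ _
  exact (contDiffOn_euclidean.1 h1) 2

lemma merP_smooth (hr₀ : 0 ≤ r₀) (hp : ContDiffOn ℝ ∞ p (cylExterior r₀)) :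
    SmoothMer r₀ (merP p) :=
  hp.comp (contDiff_cylPoint 0).contDiffOn fun _ hx => cylPoint_mem hr₀ hx _ _

/-- An axisymmetric field without swirl is determined by its values in the half plane `θ = 0`. -/
lemma velocity_eq (hr₀ : 0 ≤ r₀) (hv : AxisymVector r₀ v) (hs : NoSwirl r₀ v) {x : E3}
    (hx : x ∈ cylExterior r₀) :
    v x 0 = merU v (cylRadius x, x 2) * (x 0 / cylRadius x) ∧
    v x 1 = merU v (cylRadius x, x 2) * (x 1 / cylRadius x) ∧
    v x 2 = merW v (cylRadius x, x 2) := by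
  have hρ : r₀ < cylRadius x := hx
  have hρ0 : 0 < cylRadius x := hr₀.trans_lt hρ
  have hy := cylPoint_mem hr₀ hρ 0 (x 2)
  have hcy := cylRadius_cylPoint hρ0.le 0 (x 2)
  have e1 := hv.1 x hx _ hy hcy.symm rfl
  have e2 := hv.2.2 x hx _ hy hcy.symm rfl
  have e3 := hs x hx
  have hsq := cylRadius_sq x
  simp only [radialComp, eRad, axialComp, eAx, angularComp, eAng, hcy, PiLp.inner_apply,
    Fin.sum_univ_three] at e1 e2 e3
  simp [hρ0.ne'] at e1 e2 e3
  simp only [merU, merW]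
  set ρ := cylRadius x
  set u := v (cylPoint ρ 0 (x 2)) 0
  -- The value of v^r and the absence of swirl form a linear system for the two horizontal
  -- components, solved with the help of ρ² = x₁² + x₂².
  have e4 : x 0 * v x 0 + x 1 * v x 1 = ρ * u := by
    field_simp at e1
    linarith
  have e5 : x 0 * v x 1 = x 1 * v x 0 := by
    field_simp at e3
    linarith
  refine ⟨?_, ?_, e2⟩
  · field_simp
    refine mul_left_cancel₀ hρ0.ne' ?_
    linear_combination v x 0 * hsq + x 0 * e4 - x 1 * e5
  · field_simp
    refine mul_left_cancel₀ hρ0.ne' ?_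
    linear_combination v x 1 * hsq + x 1 * e4 + x 0 * e5

lemma velocity_cylPoint (hr₀ : 0 ≤ r₀) (hv : AxisymVector r₀ v) (hs : NoSwirl r₀ v) {r : ℝ}
    (hr : r₀ < r) (θ z : ℝ) :
    v (cylPoint r θ z) 0 = merU v (r, z) * Real.cos θ ∧
    v (cylPoint r θ z) 1 = merU v (r, z) * Real.sin θ ∧
    v (cylPoint r θ z) 2 = merW v (r, z) := by
  have h := velocity_eq hr₀ hv hs (cylPoint_mem hr₀ hr θ z)
  have hr' := hr₀.trans_lt hr
  rw [cylRadius_cylPoint hr'.le] at h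
  simpa [hr'.ne'] using h

lemma hasFDerivAt_velocity (hv : ContDiffOn ℝ ∞ v (cylExterior r₀)) {x : E3}
    (hx : x ∈ cylExterior r₀) : HasFDerivAt v (fderiv ℝ v x) x :=
  ((hv.contDiffAt ((isOpen_cylExterior r₀).mem_nhds hx)).differentiableAt (by simp)).hasFDerivAt

lemma fderiv_cyl (v : E3 → E3) (x : E3) (a b c : ℝ) (i : Fin 3) :
    fderiv ℝ v x (!₂[a, b, c]) i
      = a * partialD v 0 i x + b * partialD v 1 i x + c * partialD v 2 i x := by
  have : (!₂[a, b, c] : E3) = a • EuclideanSpace.single 0 1 + b • EuclideanSpace.single 1 1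
      + c • EuclideanSpace.single 2 1 := by
    ext j
    fin_cases j <;> simp
  rw [this]
  simp [partialD]

/-- The first derivatives of the velocity in terms of the meridional components. -/
lemma partialD_cylPoint (hr₀ : 0 ≤ r₀) (hsm : ContDiffOn ℝ ∞ v (cylExterior r₀))
    (hv : AxisymVector r₀ v) (hs : NoSwirl r₀ v) {r : ℝ} (hr : r₀ < r) (θ z : ℝ) :
    (Real.cos θ * partialD v 0 0 (cylPoint r θ z) + Real.sin θ * partialD v 1 0 (cylPoint r θ z)
      = dR (merU v) (r, z) * Real.cos θ) ∧
    (Real.cos θ * partialD v 0 2 (cylPoint r θ z) + Real.sin θ * partialD v 1 2 (cylPoint r θ z)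
      = dR (merW v) (r, z)) ∧
    partialD v 2 0 (cylPoint r θ z) = dZ (merU v) (r, z) * Real.cos θ ∧
    partialD v 2 1 (cylPoint r θ z) = dZ (merU v) (r, z) * Real.sin θ ∧
    partialD v 2 2 (cylPoint r θ z) = dZ (merW v) (r, z) ∧
    (-(r * Real.sin θ) * partialD v 0 1 (cylPoint r θ z)
      + r * Real.cos θ * partialD v 1 1 (cylPoint r θ z) = merU v (r, z) * Real.cos θ) := by
  have hF := hasFDerivAt_velocity hsm (cylPoint_mem hr₀ hr θ z)
  have hU := merU_smooth hr₀ hsm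
  have hW := merW_smooth hr₀ hsm
  have hvel := fun s (hs' : r₀ < s) θ z => velocity_cylPoint hr₀ hv hs hs' θ z
  -- Each relation compares the chain rule along a coordinate curve with the derivative of the
  -- explicit formula in `velocity_cylPoint`.
  have Dr := hasDerivAt_euclidean.1 (hF.comp_hasDerivAt r (hasDerivAt_cylPoint_r r θ z))
  have Dz := hasDerivAt_euclidean.1 (hF.comp_hasDerivAt z (hasDerivAt_cylPoint_z r θ z))
  have Dθ := hasDerivAt_euclidean.1 (hF.comp_hasDerivAt θ (hasDerivAt_cylPoint_θ r θ z))
  have hUr := hU.hasDerivAt_r z hr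
  have hUz := hU.hasDerivAt_z z hr
  have hnear : ∀ᶠ s in 𝓝 r, r₀ < s := Ioi_mem_nhds hr
  have a0 := (Dr 0).unique ((hUr.mul_const (Real.cos θ)).congr_of_eventuallyEq
    (hnear.mono fun s hs' => (hvel s hs' θ z).1))
  have a2 := (Dr 2).unique ((hW.hasDerivAt_r z hr).congr_of_eventuallyEq
    (hnear.mono fun s hs' => (hvel s hs' θ z).2.2))
  have b0 := (Dz 0).unique ((hUz.mul_const (Real.cos θ)).congr_of_eventuallyEq
    (.of_forall fun s => (hvel r hr θ s).1))
  have b1 := (Dz 1).unique ((hUz.mul_const (Real.sin θ)).congr_of_eventuallyEq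
    (.of_forall fun s => (hvel r hr θ s).2.1))
  have b2 := (Dz 2).unique ((hW.hasDerivAt_z z hr).congr_of_eventuallyEq
    (.of_forall fun s => (hvel r hr θ s).2.2))
  have c1 := (Dθ 1).unique (((Real.hasDerivAt_sin θ).const_mul (merU v (r, z))).congr_of_eventuallyEq
    (.of_forall fun s => (hvel r hr s z).2.1))
  rw [fderiv_cyl] at a0 a2 b0 b1 b2 c1
  simp only [zero_mul, add_zero, zero_add, one_mul] at a0 a2 b0 b1 b2 c1
  exact ⟨a0, a2, b0, b1, b2, c1⟩

lemma omegaTheta_cylPoint (hr₀ : 0 ≤ r₀) (hsm : ContDiffOn ℝ ∞ v (cylExterior r₀))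
    (hv : AxisymVector r₀ v) (hs : NoSwirl r₀ v) {r : ℝ} (hr : r₀ < r) (θ z : ℝ) :
    omegaTheta v (cylPoint r θ z) = merVort v (r, z) := by
  obtain ⟨-, a2, b0, b1, -, -⟩ := partialD_cylPoint hr₀ hsm hv hs hr θ z
  have hr' : 0 < r := hr₀.trans_lt hr
  have h1 : omegaTheta v (cylPoint r θ z) =
      -Real.sin θ * (partialD v 1 2 (cylPoint r θ z) - partialD v 2 1 (cylPoint r θ z))
      + Real.cos θ * (partialD v 2 0 (cylPoint r θ z) - partialD v 0 2 (cylPoint r θ z)) := by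
    simp only [omegaTheta, angularComp, eAng, curl, cylRadius_cylPoint hr'.le, PiLp.inner_apply,
      Fin.sum_univ_three]
    simp [hr'.ne', neg_div]
  rw [h1, merVort, ← a2, b0, b1]
  linear_combination dZ (merU v) (r, z) * Real.sin_sq_add_cos_sq θ

/-- The z-derivatives of the two horizontal components are ∂_zU times (cos θ, sin θ), so (∂_zU)² is
part of the Frobenius sum. -/
lemma abs_dZ_merU_le (hr₀ : 0 ≤ r₀) (hsm : ContDiffOn ℝ ∞ v (cylExterior r₀))
    (hv : AxisymVector r₀ v) (hs : NoSwirl r₀ v) {r : ℝ} (hr : r₀ < r) (θ z : ℝ) :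
    |dZ (merU v) (r, z)| ≤ gradNorm v (cylPoint r θ z) := by
  obtain ⟨-, -, b0, b1, -, -⟩ := partialD_cylPoint hr₀ hsm hv hs hr θ z
  refine Real.abs_le_sqrt ?_
  have : dZ (merU v) (r, z) ^ 2
      = partialD v 2 0 (cylPoint r θ z) ^ 2 + partialD v 2 1 (cylPoint r θ z) ^ 2 := by
    rw [b0, b1]
    linear_combination -dZ (merU v) (r, z) ^ 2 * Real.sin_sq_add_cos_sq θ
  rw [this]
  simp only [Fin.sum_univ_three]
  nlinarith [sq_nonneg (partialD v 0 0 (cylPoint r θ z)), sq_nonneg (partialD v 1 0 (cylPoint r θ z)),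
    sq_nonneg (partialD v 0 1 (cylPoint r θ z)), sq_nonneg (partialD v 1 1 (cylPoint r θ z)),
    sq_nonneg (partialD v 0 2 (cylPoint r θ z)), sq_nonneg (partialD v 1 2 (cylPoint r θ z)),
    sq_nonneg (partialD v 2 2 (cylPoint r θ z))]

/-- Here ∂_rW is the component along e_r of the horizontal gradient of v₃, hence bounded by its
length. -/
lemma abs_dR_merW_le (hr₀ : 0 ≤ r₀) (hsm : ContDiffOn ℝ ∞ v (cylExterior r₀))
    (hv : AxisymVector r₀ v) (hs : NoSwirl r₀ v) {r : ℝ} (hr : r₀ < r) (θ z : ℝ) :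
    |dR (merW v) (r, z)| ≤ gradNorm v (cylPoint r θ z) := by
  obtain ⟨-, a2, -, -, -, -⟩ := partialD_cylPoint hr₀ hsm hv hs hr θ z
  refine Real.abs_le_sqrt ?_
  have : dR (merW v) (r, z) ^ 2
      ≤ partialD v 0 2 (cylPoint r θ z) ^ 2 + partialD v 1 2 (cylPoint r θ z) ^ 2 := by
    rw [← a2]
    have h1 := sq_nonneg (Real.sin θ * partialD v 0 2 (cylPoint r θ z)
      - Real.cos θ * partialD v 1 2 (cylPoint r θ z))
    have h2 : (partialD v 0 2 (cylPoint r θ z) ^ 2 + partialD v 1 2 (cylPoint r θ z) ^ 2)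
      = (partialD v 0 2 (cylPoint r θ z) ^ 2 + partialD v 1 2 (cylPoint r θ z) ^ 2)
        * (Real.sin θ ^ 2 + Real.cos θ ^ 2) := by rw [Real.sin_sq_add_cos_sq, mul_one]
    rw [h2]
    linarith
  refine this.trans ?_
  simp only [Fin.sum_univ_three]
  nlinarith [sq_nonneg (partialD v 0 0 (cylPoint r θ z)), sq_nonneg (partialD v 1 0 (cylPoint r θ z)),
    sq_nonneg (partialD v 0 1 (cylPoint r θ z)), sq_nonneg (partialD v 1 1 (cylPoint r θ z)),
    sq_nonneg (partialD v 2 0 (cylPoint r θ z)), sq_nonneg (partialD v 2 1 (cylPoint r θ z)),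
    sq_nonneg (partialD v 2 2 (cylPoint r θ z))]

/-- At θ = 0 the derivative ∂₂v₂ equals U/r, because the frame turns with the angle; the other two
diagonal entries are ∂_rU and ∂_zW. -/
lemma meridional_div_free (hr₀ : 0 ≤ r₀) (hNS : IsPeriodicSteadyNS r₀ v p)
    (hv : AxisymVector r₀ v) (hs : NoSwirl r₀ v) {r : ℝ} (hr : r₀ < r) (z : ℝ) :
    merU v (r, z) + r * (dR (merU v) (r, z) + dZ (merW v) (r, z)) = 0 := by
  obtain ⟨a0, -, -, -, b2, c1⟩ := partialD_cylPoint hr₀ hNS.smooth_v hv hs hr 0 z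
  have h := hNS.div_free _ (cylPoint_mem hr₀ hr 0 z)
  simp only [divergence, Fin.sum_univ_three] at h
  simp only [Real.cos_zero, Real.sin_zero, one_mul, zero_mul, mul_zero, mul_one, neg_zero,
    add_zero, zero_add] at a0 b2 c1
  rw [a0, b2] at h
  linear_combination r * h - c1

end Pointwise

/-! ### The Laplacian and the momentum equations in the half plane -/

/-- A second directional derivative computed along a line. -/
lemma fderiv_fderiv_apply_eq {f : E3 → ℝ} {x e : E3} (hf : ContDiffAt ℝ 2 f x) {g' : ℝ → ℝ} {c : ℝ}
    (hg : ∀ᶠ t in 𝓝 (0 : ℝ), HasDerivAt (fun t => f (x + t • e)) (g' t) t)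
    (hg' : HasDerivAt g' c 0) : fderiv ℝ (fderiv ℝ f) x e e = c := by
  have hline : ∀ t : ℝ, HasDerivAt (fun t : ℝ => x + t • e) e t := fun t => by
    simpa using ((hasDerivAt_id t).smul_const e).const_add x
  have hx : x + (0 : ℝ) • e = x := by simp
  have hdiff : ∀ᶠ y in 𝓝 x, DifferentiableAt ℝ f y :=
    (hf.eventually (by simp)).mono fun y hy => hy.differentiableAt (by simp)
  have hcont : Tendsto (fun t : ℝ => x + t • e) (𝓝 0) (𝓝 x) := by
    have := (hline 0).continuousAt.tendsto
    rwa [hx] at this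
  have h1 : ∀ᶠ t in 𝓝 (0 : ℝ), g' t = fderiv ℝ f (x + t • e) e := by
    filter_upwards [hg, hcont.eventually hdiff] with t ht1 ht2
    exact ht1.unique (ht2.hasFDerivAt.comp_hasDerivAt t (hline t))
  have h2 : HasFDerivAt (fderiv ℝ f) (fderiv ℝ (fderiv ℝ f) x) (x + (0 : ℝ) • e) := by
    rw [hx]
    exact ((hf.fderiv_right (m := 1) (by norm_num)).differentiableAt (by simp)).hasFDerivAt
  have h3 : HasDerivAt (fun t : ℝ => fderiv ℝ f (x + t • e)) (fderiv ℝ (fderiv ℝ f) x e) 0 :=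
    h2.comp_hasDerivAt (0 : ℝ) (hline 0)
  have h4 : HasDerivAt (fun t : ℝ => fderiv ℝ f (x + t • e) e) (fderiv ℝ (fderiv ℝ f) x e e) 0 :=
    (ContinuousLinearMap.apply ℝ ℝ e).hasFDerivAt.comp_hasDerivAt (0 : ℝ) h3
  exact (h4.congr_of_eventuallyEq h1).unique hg'

lemma laplacian_apply {v : E3 → E3} {x : E3} (hv : ContDiffAt ℝ 2 v x) (i : Fin 3) :
    (Laplacian.laplacian v x) i
      = ∑ j, fderiv ℝ (fderiv ℝ fun y => v y i) x (EuclideanSpace.single j 1)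
        (EuclideanSpace.single j 1) := by
  have h1 := hv.laplacian_CLM_comp_left (l := (EuclideanSpace.proj i : E3 →L[ℝ] ℝ))
  have h2 : (EuclideanSpace.proj i : E3 →L[ℝ] ℝ) ∘ v = fun y => v y i := rfl
  rw [h2] at h1
  simp only [Function.comp_apply, PiLp.proj_apply] at h1
  rw [← h1, InnerProductSpace.laplacian_eq_iteratedFDeriv_orthonormalBasis _
    (EuclideanSpace.basisFun (Fin 3) ℝ)]
  simp [iteratedFDeriv_two_apply]

/-- The second derivative at `0` of an even function of the form `t ↦ F (√(r² + t²))`. -/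
lemma hasDerivAt_even {F F' : ℝ → ℝ} {r : ℝ} (hr : 0 < r) (hF : ∀ᶠ s in 𝓝 r, HasDerivAt F (F' s) s)
    (hF' : ContinuousAt F' r) :
    (∀ᶠ t in 𝓝 (0 : ℝ), HasDerivAt (fun t => F (√(r ^ 2 + t ^ 2)))
      (t * (F' (√(r ^ 2 + t ^ 2)) / √(r ^ 2 + t ^ 2))) t) ∧
    HasDerivAt (fun t => t * (F' (√(r ^ 2 + t ^ 2)) / √(r ^ 2 + t ^ 2))) (F' r / r) 0 := by
  have hρ0 : √(r ^ 2 + (0 : ℝ) ^ 2) = r := by simp [Real.sqrt_sq hr.le]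
  have hρc : Continuous fun t : ℝ => √(r ^ 2 + t ^ 2) := by fun_prop
  have hρt : Tendsto (fun t : ℝ => √(r ^ 2 + t ^ 2)) (𝓝 0) (𝓝 r) := by
    have := hρc.tendsto 0
    rwa [hρ0] at this
  constructor
  · filter_upwards [hρt.eventually hF] with t ht
    have hpos : 0 < r ^ 2 + t ^ 2 := by positivity
    have h1 : HasDerivAt (fun t : ℝ => r ^ 2 + t ^ 2) (2 * t) t := by
      simpa using (hasDerivAt_pow 2 t).const_add (r ^ 2)
    have h2 := ht.comp t (h1.sqrt hpos.ne')
    refine h2.congr_deriv ?_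
    have := (Real.sqrt_pos.2 hpos).ne'
    field_simp
  · have hk : ContinuousAt (fun t : ℝ => F' (√(r ^ 2 + t ^ 2)) / √(r ^ 2 + t ^ 2)) 0 := by
      have e1 : ContinuousAt (fun t : ℝ => F' (√(r ^ 2 + t ^ 2))) 0 :=
        ContinuousAt.comp' (by rwa [hρ0]) hρc.continuousAt
      exact e1.div hρc.continuousAt (by rw [hρ0]; exact hr.ne')
    -- For a function t·k(t) the difference quotient at 0 is k(t) itself, so continuity of k
    -- suffices and F' need not be differentiable.
    rw [hasDerivAt_iff_tendsto_slope]
    have h3 : Tendsto (fun t : ℝ => F' (√(r ^ 2 + t ^ 2)) / √(r ^ 2 + t ^ 2)) (𝓝[≠] 0)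
        (𝓝 (F' r / r)) := by
      have := hk.tendsto
      simp only [hρ0] at this
      exact this.mono_left nhdsWithin_le_nhds
    refine h3.congr' ?_
    filter_upwards [self_mem_nhdsWithin] with t ht
    have ht0 : t ≠ 0 := ht
    simp only [slope_def_field, zero_mul, sub_zero]
    field_simp

lemma SmoothMer.continuousAt_r {r₀ : ℝ} {F : ℝ × ℝ → ℝ} (hF : SmoothMer r₀ F) {r : ℝ} (z : ℝ)
    (hr : r₀ < r) : ContinuousAt (fun s => F (s, z)) r :=
  (hF.hasDerivAt_r z hr).continuousAt

section Momentum

variable {r₀ : ℝ} {v : E3 → E3} {p : E3 → ℝ}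

lemma contDiffAt_velocity (hsm : ContDiffOn ℝ ∞ v (cylExterior r₀)) {x : E3}
    (hx : x ∈ cylExterior r₀) : ContDiffAt ℝ 2 v x :=
  (hsm.contDiffAt ((isOpen_cylExterior r₀).mem_nhds hx)).of_le
    (WithTop.coe_le_coe.2 (le_top (a := (2 : ℕ∞))))

/-- The Laplacian, in the half plane `θ = 0`, of a velocity component which depends on `x₂` only
through `√(x₁² + x₂²)`. -/
lemma sum_fderiv_fderiv_eq (hr₀ : 0 ≤ r₀) (hsm : ContDiffOn ℝ ∞ v (cylExterior r₀)) {i : Fin 3}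
    {F : ℝ × ℝ → ℝ} (hF : SmoothMer r₀ F) {B B' : ℝ → ℝ} {r z : ℝ} (hr : r₀ < r)
    (hFv : ∀ s, r₀ < s → ∀ w, v (cylPoint s 0 w) i = F (s, w))
    (hB : ∀ t : ℝ, v (!₂[r, t, z]) i = B (√(r ^ 2 + t ^ 2)))
    (hBd : ∀ s, r₀ < s → HasDerivAt B (B' s) s) (hBc : ContinuousAt B' r) :
    (Laplacian.laplacian v (cylPoint r 0 z)) i
      = dR (dR F) (r, z) + dZ (dZ F) (r, z) + B' r / r := by
  have hx := cylPoint_mem hr₀ hr 0 z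
  have hv2 := contDiffAt_velocity hsm hx
  have hvi : ContDiffAt ℝ 2 (fun y => v y i) (cylPoint r 0 z) := (contDiffAt_euclidean.1 hv2) i
  rw [laplacian_apply hv2, Fin.sum_univ_three]
  have hnear : ∀ᶠ s in 𝓝 r, r₀ < s := Ioi_mem_nhds hr
  have hshift : HasDerivAt (fun t : ℝ => r + t) 1 0 := by
    simpa using (hasDerivAt_id (0 : ℝ)).const_add r
  have hnear0 : ∀ᶠ t in 𝓝 (0 : ℝ), r₀ < r + t := by
    have : Tendsto (fun t : ℝ => r + t) (𝓝 0) (𝓝 r) := by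
      simpa using hshift.continuousAt.tendsto
    exact this.eventually hnear
  have e0 : fderiv ℝ (fderiv ℝ fun y => v y i) (cylPoint r 0 z) (EuclideanSpace.single 0 1)
      (EuclideanSpace.single 0 1) = dR (dR F) (r, z) := by
    refine fderiv_fderiv_apply_eq hvi (g' := fun t => dR F (r + t, z)) ?_ ?_
    · filter_upwards [hnear0, hnear0.eventually_nhds] with t ht ht'
      have h1 : HasDerivAt (fun t => F (r + t, z)) (dR F (r + t, z)) t := by
        have := (hF.hasDerivAt_r z ht).comp t ((hasDerivAt_id t).const_add r)
        simpa [Function.comp_def] using this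
      refine h1.congr_of_eventuallyEq (ht'.mono fun s hs => ?_)
      have hpt : cylPoint r 0 z + s • EuclideanSpace.single 0 1 = cylPoint (r + s) 0 z := by
        ext j
        fin_cases j <;> simp
      simp only
      rw [hpt, hFv _ hs]
    · have h1 : HasDerivAt (fun s => dR F (s, z)) (dR (dR F) (r, z)) (r + 0) := by
        rw [add_zero]
        exact hF.dR.hasDerivAt_r z hr
      simpa [Function.comp_def] using h1.comp (0 : ℝ) hshift
  have e2 : fderiv ℝ (fderiv ℝ fun y => v y i) (cylPoint r 0 z) (EuclideanSpace.single 2 1)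
      (EuclideanSpace.single 2 1) = dZ (dZ F) (r, z) := by
    refine fderiv_fderiv_apply_eq hvi (g' := fun t => dZ F (r, z + t)) ?_ ?_
    · refine .of_forall fun t => ?_
      have h1 : HasDerivAt (fun t => F (r, z + t)) (dZ F (r, z + t)) t := by
        have := (hF.hasDerivAt_z (z + t) hr).comp t ((hasDerivAt_id t).const_add z)
        simpa [Function.comp_def] using this
      refine h1.congr_of_eventuallyEq (.of_forall fun s => ?_)
      have hpt : cylPoint r 0 z + s • EuclideanSpace.single 2 1 = cylPoint r 0 (z + s) := by
        ext j
        fin_cases j <;> simp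
      simp only
      rw [hpt, hFv _ hr]
    · have h1 : HasDerivAt (fun s => dZ F (r, s)) (dZ (dZ F) (r, z)) (z + 0) := by
        rw [add_zero]
        exact hF.dZ.hasDerivAt_z z hr
      have h2 : HasDerivAt (fun t : ℝ => z + t) 1 0 := by
        simpa using (hasDerivAt_id (0 : ℝ)).const_add z
      simpa [Function.comp_def] using h1.comp (0 : ℝ) h2
  have e1 : fderiv ℝ (fderiv ℝ fun y => v y i) (cylPoint r 0 z) (EuclideanSpace.single 1 1)
      (EuclideanSpace.single 1 1) = B' r / r := by
    obtain ⟨h1, h2⟩ := hasDerivAt_even (hr₀.trans_lt hr) (hnear.mono hBd) hBc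
    refine fderiv_fderiv_apply_eq hvi (h1.mono fun t ht => ?_) h2
    refine ht.congr_of_eventuallyEq (.of_forall fun s => ?_)
    have hpt : cylPoint r 0 z + s • EuclideanSpace.single 1 1 = !₂[r, s, z] := by
      ext j
      fin_cases j <;> simp
    simp only
    rw [hpt, hB]
  rw [e0, e1, e2]
  ring

lemma gradient_apply (p : E3 → ℝ) (x : E3) (i : Fin 3) : gradient p x i = fderiv ℝ p x (EuclideanSpace.single i 1) := by
  have h1 : inner ℝ (gradient p x) (EuclideanSpace.single i (1 : ℝ))
      = fderiv ℝ p x (EuclideanSpace.single i 1) := by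
    rw [gradient, InnerProductSpace.toDual_symm_apply]
  rw [← h1, EuclideanSpace.inner_single_right]
  simp

/-- Describes the velocity along the x₂-direction through a point of the half plane, the only second
derivative not tangent to it. The factor r/√(r² + t²) is the cosine of the angle. -/
lemma velocity_line (hr₀ : 0 ≤ r₀) (hv : AxisymVector r₀ v) (hs : NoSwirl r₀ v) {r : ℝ}
    (hr : r₀ < r) (t z : ℝ) :
    v (!₂[r, t, z]) 0 = merU v (√(r ^ 2 + t ^ 2), z) * (r / √(r ^ 2 + t ^ 2)) ∧
    v (!₂[r, t, z]) 2 = merW v (√(r ^ 2 + t ^ 2), z) := by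
  have hmem : (!₂[r, t, z] : E3) ∈ cylExterior r₀ := by
    have : r₀ < √(r ^ 2 + t ^ 2) :=
      hr.trans_le (Real.le_sqrt_of_sq_le (by nlinarith [sq_nonneg t]))
    simpa [cylExterior, cylRadius] using this
  have h := velocity_eq hr₀ hv hs hmem
  have hρ : cylRadius (!₂[r, t, z] : E3) = √(r ^ 2 + t ^ 2) := by simp [cylRadius]
  rw [hρ] at h
  exact ⟨by simpa using h.1, by simpa using h.2.2⟩

/-- The radial and the axial momentum equation. -/
lemma meridional_momentum (hr₀ : 0 ≤ r₀) (hNS : IsPeriodicSteadyNS r₀ v p)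
    (hv : AxisymVector r₀ v) (hs : NoSwirl r₀ v) {r : ℝ} (hr : r₀ < r) (z : ℝ) :
    (merU v (r, z) * dR (merU v) (r, z) + merW v (r, z) * dZ (merU v) (r, z) + dR (merP p) (r, z)
      = dR (dR (merU v)) (r, z) + dZ (dZ (merU v)) (r, z)
        + (dR (merU v) (r, z) - merU v (r, z) / r) / r) ∧
    (merU v (r, z) * dR (merW v) (r, z) + merW v (r, z) * dZ (merW v) (r, z) + dZ (merP p) (r, z)
      = dR (dR (merW v)) (r, z) + dZ (dZ (merW v)) (r, z) + dR (merW v) (r, z) / r) := by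
  have hr' : 0 < r := hr₀.trans_lt hr
  have hx := cylPoint_mem hr₀ hr 0 z
  have hU := merU_smooth hr₀ hNS.smooth_v
  have hW := merW_smooth hr₀ hNS.smooth_v
  have hP := merP_smooth hr₀ hNS.smooth_p
  obtain ⟨a0, a2, b0, -, b2, -⟩ := partialD_cylPoint hr₀ hNS.smooth_v hv hs hr 0 z
  simp only [Real.cos_zero, Real.sin_zero, one_mul, zero_mul, mul_one, add_zero] at a0 a2 b0 b2
  have hvel := velocity_cylPoint hr₀ hv hs hr 0 z
  simp only [Real.cos_zero, Real.sin_zero, mul_zero, mul_one] at hvel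
  have hvx : v (cylPoint r 0 z) = !₂[merU v (r, z), 0, merW v (r, z)] := by
    ext j
    fin_cases j
    · exact hvel.1
    · exact hvel.2.1
    · exact hvel.2.2
  have hpd : HasFDerivAt p (fderiv ℝ p (cylPoint r 0 z)) (cylPoint r 0 z) :=
    ((hNS.smooth_p.contDiffAt ((isOpen_cylExterior r₀).mem_nhds hx)).differentiableAt
      (by simp)).hasFDerivAt
  have hPr : fderiv ℝ p (cylPoint r 0 z) (EuclideanSpace.single 0 1) = dR (merP p) (r, z) := by
    refine HasDerivAt.unique ?_ (hP.hasDerivAt_r z hr)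
    have h1 := hpd.comp_hasDerivAt r (hasDerivAt_cylPoint_r r 0 z)
    have h2 : (!₂[Real.cos 0, Real.sin 0, 0] : E3) = EuclideanSpace.single 0 1 := by
      ext j
      fin_cases j <;> simp
    rw [h2] at h1
    exact h1
  have hPz : fderiv ℝ p (cylPoint r 0 z) (EuclideanSpace.single 2 1) = dZ (merP p) (r, z) := by
    refine HasDerivAt.unique ?_ (hP.hasDerivAt_z z hr)
    have h1 := hpd.comp_hasDerivAt z (hasDerivAt_cylPoint_z r 0 z)
    have h2 : (!₂[0, 0, 1] : E3) = EuclideanSpace.single 2 1 := by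
      ext j
      fin_cases j <;> simp
    rw [h2] at h1
    exact h1
  have hconv : ∀ i, fderiv ℝ v (cylPoint r 0 z) (v (cylPoint r 0 z)) i
      = merU v (r, z) * partialD v 0 i (cylPoint r 0 z)
        + merW v (r, z) * partialD v 2 i (cylPoint r 0 z) := by
    intro i
    rw [hvx, fderiv_cyl]
    ring
  have hmom := hNS.momentum _ hx
  have hm0 := congrArg (fun w : E3 => w 0) hmom
  have hm2 := congrArg (fun w : E3 => w 2) hmom
  simp only [PiLp.add_apply] at hm0 hm2
  -- At s = r this derivative divided by r is (∂_rU - U/r)/r, which contains the term -U/r² of the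
  -- vector Laplacian.
  have hBd : ∀ s, r₀ < s → HasDerivAt (fun s => merU v (s, z) * (r / s))
      (dR (merU v) (s, z) * (r / s) + merU v (s, z) * (-r / s ^ 2)) s := fun s hs =>
    ((hU.hasDerivAt_r z hs).mul ((hasDerivAt_const s r).div (hasDerivAt_id s)
      (hr₀.trans_lt hs).ne')).congr_deriv (by simp)
  have hBc : ContinuousAt (fun s => dR (merU v) (s, z) * (r / s) + merU v (s, z) * (-r / s ^ 2)) r :=
    ((hU.dR.continuousAt_r z hr).mul (continuousAt_const.div continuousAt_id hr'.ne')).add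
      ((hU.continuousAt_r z hr).mul (continuousAt_const.div (continuousAt_id.pow 2)
        (pow_ne_zero 2 hr'.ne')))
  rw [hconv, gradient_apply, hPr, a0, b0,
    sum_fderiv_fderiv_eq hr₀ hNS.smooth_v hU hr (fun s _ w => rfl)
      (fun t => (velocity_line hr₀ hv hs hr t z).1)
      hBd hBc] at hm0
  rw [hconv, gradient_apply, hPz, a2, b2,
    sum_fderiv_fderiv_eq hr₀ hNS.smooth_v hW hr (fun s _ w => rfl)
      (fun t => (velocity_line hr₀ hv hs hr t z).2)
      (fun s hs => hW.hasDerivAt_r z hs) (hW.dR.continuousAt_r z hr)] at hm2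
  refine ⟨?_, hm2⟩
  rw [hm0]
  field_simp
  ring

end Momentum

/-! ### The vorticity equation -/

section Congr

variable {r₀ : ℝ} {F G : ℝ × ℝ → ℝ}

lemma fderiv_meridian_congr (h : ∀ r z, r₀ < r → F (r, z) = G (r, z)) {r : ℝ} (z : ℝ)
    (hr : r₀ < r) : fderiv ℝ F (r, z) = fderiv ℝ G (r, z) := by
  refine Filter.EventuallyEq.fderiv_eq ?_
  filter_upwards [(isOpen_meridian r₀).mem_nhds (x := (r, z)) hr] with x hx using h x.1 x.2 hx

lemma dR_congr (h : ∀ r z, r₀ < r → F (r, z) = G (r, z)) : ∀ r z, r₀ < r →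
    dR F (r, z) = dR G (r, z) := fun r z hr => by
  simp only [dR, fderiv_meridian_congr h z hr]

lemma dZ_congr (h : ∀ r z, r₀ < r → F (r, z) = G (r, z)) : ∀ r z, r₀ < r →
    dZ F (r, z) = dZ G (r, z) := fun r z hr => by
  simp only [dZ, fderiv_meridian_congr h z hr]

lemma dR_sub (hF : SmoothMer r₀ F) (hG : SmoothMer r₀ G) : ∀ r z, r₀ < r →
    dR (fun x => F x - G x) (r, z) = dR F (r, z) - dR G (r, z) := fun _ z hr =>
  ((hF.sub hG).hasDerivAt_r z hr).unique ((hF.hasDerivAt_r z hr).sub (hG.hasDerivAt_r z hr))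

lemma dZ_sub (hF : SmoothMer r₀ F) (hG : SmoothMer r₀ G) : ∀ r z, r₀ < r →
    dZ (fun x => F x - G x) (r, z) = dZ F (r, z) - dZ G (r, z) := fun _ z hr =>
  ((hF.sub hG).hasDerivAt_z z hr).unique ((hF.hasDerivAt_z z hr).sub (hG.hasDerivAt_z z hr))

lemma dR_add (hF : SmoothMer r₀ F) (hG : SmoothMer r₀ G) : ∀ r z, r₀ < r →
    dR (fun x => F x + G x) (r, z) = dR F (r, z) + dR G (r, z) := fun _ z hr =>
  ((hF.add hG).hasDerivAt_r z hr).unique ((hF.hasDerivAt_r z hr).add (hG.hasDerivAt_r z hr))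

lemma dR_fst_mul (hF : SmoothMer r₀ F) : ∀ r z, r₀ < r →
    dR (fun x => x.1 * F x) (r, z) = F (r, z) + r * dR F (r, z) := fun r z hr => by
  have h := (((SmoothMer.fst r₀).mul hF).hasDerivAt_r z hr).unique
    ((hasDerivAt_id r).mul (hF.hasDerivAt_r z hr))
  simpa using h

lemma dZ_fst_mul (hF : SmoothMer r₀ F) : ∀ r z, r₀ < r →
    dZ (fun x => x.1 * F x) (r, z) = r * dZ F (r, z) := fun r z hr =>
  (((SmoothMer.fst r₀).mul hF).hasDerivAt_z z hr).unique ((hF.hasDerivAt_z z hr).const_mul r)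

end Congr

/-- The vorticity equation, obtained by eliminating the pressure from the momentum equations. -/
lemma vorticity_eq_of_momentum {r₀ : ℝ} (hr₀ : 0 ≤ r₀) {U W P Om : ℝ × ℝ → ℝ}
    (hU : SmoothMer r₀ U) (hW : SmoothMer r₀ W) (hP : SmoothMer r₀ P) (hOm : SmoothMer r₀ Om)
    (hOmdef : ∀ r z, r₀ < r → dZ U (r, z) - dR W (r, z) = r * Om (r, z))
    (hdiv : ∀ r z, r₀ < r → U (r, z) + r * (dR U (r, z) + dZ W (r, z)) = 0)
    (hmomr : ∀ r z, r₀ < r → U (r, z) * dR U (r, z) + W (r, z) * dZ U (r, z) + dR P (r, z)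
      = dR (dR U) (r, z) + dZ (dZ U) (r, z) + (dR U (r, z) - U (r, z) / r) / r)
    (hmomz : ∀ r z, r₀ < r → U (r, z) * dR W (r, z) + W (r, z) * dZ W (r, z) + dZ P (r, z)
      = dR (dR W) (r, z) + dZ (dZ W) (r, z) + dR W (r, z) / r) {r : ℝ} (z : ℝ) (hr : r₀ < r) :
    U (r, z) * dR Om (r, z) + W (r, z) * dZ Om (r, z) =
      dR (dR Om) (r, z) + 3 / r * dR Om (r, z) + dZ (dZ Om) (r, z) := by
  have hr' : r ≠ 0 := (hr₀.trans_lt hr).ne'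
  have hnear : ∀ᶠ s in 𝓝 r, r₀ < s := Ioi_mem_nhds hr
  -- The z-derivative of the radial equation; `eT` is the r-derivative of the axial one. In the
  -- difference the mixed derivatives of the pressure cancel.
  have eS := (((((hU.hasDerivAt_z z hr).mul (hU.dR.hasDerivAt_z z hr)).add
    ((hW.hasDerivAt_z z hr).mul (hU.dZ.hasDerivAt_z z hr))).add
      (hP.dR.hasDerivAt_z z hr)).congr_of_eventuallyEq
      (.of_forall fun s => (hmomr r s hr).symm)).unique
    (((hU.dR.dR.hasDerivAt_z z hr).add (hU.dZ.dZ.hasDerivAt_z z hr)).add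
      (((hU.dR.hasDerivAt_z z hr).sub ((hU.hasDerivAt_z z hr).div_const r)).div_const r))
  have eT := (((((hU.hasDerivAt_r z hr).mul (hW.dR.hasDerivAt_r z hr)).add
    ((hW.hasDerivAt_r z hr).mul (hW.dZ.hasDerivAt_r z hr))).add
      (hP.dZ.hasDerivAt_r z hr)).congr_of_eventuallyEq
      (hnear.mono fun s hs => (hmomz s z hs).symm)).unique
    (((hW.dR.dR.hasDerivAt_r z hr).add (hW.dZ.dZ.hasDerivAt_r z hr)).add
      ((hW.dR.hasDerivAt_r z hr).div (hasDerivAt_id r) hr'))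
  have cU := fun r z (hr : r₀ < r) => hU.dR_dZ z hr
  have cW := fun r z (hr : r₀ < r) => hW.dR_dZ z hr
  have c1 : dZ (dR (dR U)) (r, z) = dR (dR (dZ U)) (r, z) := by
    rw [← hU.dR.dR_dZ z hr, dR_congr cU r z hr]
  have c2 : dR (dZ (dZ W)) (r, z) = dZ (dZ (dR W)) (r, z) := by
    rw [hW.dZ.dR_dZ z hr, dZ_congr cW r z hr]
  have o1 : ∀ r z, r₀ < r → dR (dZ U) (r, z) - dR (dR W) (r, z)
      = Om (r, z) + r * dR Om (r, z) := fun r z hr => by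
    rw [← dR_sub hU.dZ hW.dR r z hr, ← dR_fst_mul hOm r z hr]
    exact dR_congr (fun r z hr => hOmdef r z hr) r z hr
  have o2 : dR (dR (dZ U)) (r, z) - dR (dR (dR W)) (r, z)
      = dR Om (r, z) + (dR Om (r, z) + r * dR (dR Om) (r, z)) := by
    rw [← dR_sub hU.dZ.dR hW.dR.dR r z hr, ← dR_fst_mul hOm.dR r z hr,
      ← dR_add hOm ((SmoothMer.fst r₀).mul hOm.dR) r z hr]
    exact dR_congr (fun r z hr => o1 r z hr) r z hr
  have o3 : ∀ r z, r₀ < r → dZ (dZ U) (r, z) - dZ (dR W) (r, z) = r * dZ Om (r, z) :=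
    fun r z hr => by
    rw [← dZ_sub hU.dZ hW.dR r z hr, ← dZ_fst_mul hOm r z hr]
    exact dZ_congr (fun r z hr => hOmdef r z hr) r z hr
  have o4 : dZ (dZ (dZ U)) (r, z) - dZ (dZ (dR W)) (r, z) = r * dZ (dZ Om) (r, z) := by
    rw [← dZ_sub hU.dZ.dZ hW.dR.dZ r z hr, ← dZ_fst_mul hOm.dZ r z hr]
    exact dZ_congr (fun r z hr => o3 r z hr) r z hr
  have hd := hdiv r z hr
  have o0 := hOmdef r z hr
  have o1' := o1 r z hr
  have o3' := o3 r z hr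
  rw [c1] at eS
  rw [c2, hP.dR_dZ z hr, cW r z hr] at eT
  rw [← cU r z hr] at eS
  simp only [mul_one] at eT
  field_simp at eS eT ⊢
  refine mul_left_cancel₀ (pow_ne_zero 2 hr') ?_
  -- The curl of the convective term contains (∂_rU + ∂_zW)rΩ, which is -UΩ by incompressibility and
  -- cancels the UΩ in U∂_r(rΩ). On the viscous side, Ω = ω^θ/r cancels the zeroth-order term.
  linear_combination eS - eT - r ^ 2 * Om (r, z) * hd
    - r ^ 2 * (dR U (r, z) + dZ W (r, z)) * o0 - r ^ 2 * U (r, z) * o1' - r ^ 2 * W (r, z) * o3'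
    + r ^ 2 * o2 + r ^ 2 * o4 + r * o1' - o0

lemma meridionalFlow {r₀ : ℝ} (hr₀ : 0 ≤ r₀) {v : E3 → E3} {p : E3 → ℝ}
    (hNS : IsPeriodicSteadyNS r₀ v p) (hv : AxisymVector r₀ v) (hs : NoSwirl r₀ v) :
    MeridionalFlow r₀ (merU v) (merW v) (fun x => merVort v x / x.1) := by
  have hU := merU_smooth hr₀ hNS.smooth_v
  have hW := merW_smooth hr₀ hNS.smooth_v
  have hOm : SmoothMer r₀ (fun x => merVort v x / x.1) := (hU.dZ.sub hW.dR).div_fst hr₀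
  have hper : ∀ r z, r₀ < r → v (cylPoint r 0 (z + 2 * Real.pi)) = v (cylPoint r 0 z) := by
    intro r z hr
    rw [← hNS.periodic _ (cylPoint_mem hr₀ hr 0 z)]
    congr 1
    ext j
    fin_cases j <;> simp
  have hpU : PeriodicMer r₀ (merU v) := fun r z hr => by simp only [merU, hper r z hr]
  have hpW : PeriodicMer r₀ (merW v) := fun r z hr => by simp only [merW, hper r z hr]
  have hdiv := fun r z (hr : r₀ < r) => meridional_div_free hr₀ hNS hv hs hr z
  refine ⟨hr₀, hU, hW, hOm, hpU, hpW, fun r z hr => ?_, hdiv, fun r z hr => ?_⟩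
  · simp only [merVort, hpU.dZ r z hr, hpW.dR r z hr]
  · refine vorticity_eq_of_momentum hr₀ hU hW (merP_smooth hr₀ hNS.smooth_p) hOm
      (fun r z hr => ?_) hdiv (fun r z hr => (meridional_momentum hr₀ hNS hv hs hr z).1)
      (fun r z hr => (meridional_momentum hr₀ hNS hv hs hr z).2) z hr
    have hr' : r ≠ 0 := (hr₀.trans_lt hr).ne'
    simp only [merVort]
    field_simp

/-! ### Integration in cylindrical coordinates -/

lemma exists_eq_cylPoint (x : E3) : ∃ θ, x = cylPoint (cylRadius x) θ (x 2) := by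
  have hn : cylRadius x = ‖(⟨x 0, x 1⟩ : ℂ)‖ := by
    rw [Complex.norm_eq_sqrt_sq_add_sq, cylRadius]
  refine ⟨Complex.arg ⟨x 0, x 1⟩, ?_⟩
  ext j
  fin_cases j
  · simp [hn, Complex.norm_mul_cos_arg]
  · simp [hn, Complex.norm_mul_sin_arg]
  · simp

/-- Integration of an axisymmetric function over `ℝ³` in cylindrical coordinates. -/
lemma lintegral_cylindrical {φ : ℝ × ℝ → ENNReal} (hφ : Measurable φ) :
    ∫⁻ x : E3, φ (cylRadius x, x 2) = ENNReal.ofReal (2 * Real.pi) *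
      ∫⁻ y in Ioi (0 : ℝ) ×ˢ univ, ENNReal.ofReal y.1 * φ y := by
  have hm3 : Measurable fun y : Fin 3 → ℝ => φ (√(y 0 ^ 2 + y 1 ^ 2), y 2) := by fun_prop
  have s1 : ∫⁻ x : E3, φ (cylRadius x, x 2)
      = ∫⁻ y : Fin 3 → ℝ, φ (√(y 0 ^ 2 + y 1 ^ 2), y 2) :=
    (PiLp.volume_preserving_ofLp (Fin 3)).lintegral_comp hm3
  have hm2 : Measurable fun y : ℝ × (Fin 2 → ℝ) => φ (√(y.2 0 ^ 2 + y.2 1 ^ 2), y.1) := by fun_prop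
  have s2 : ∫⁻ y : Fin 3 → ℝ, φ (√(y 0 ^ 2 + y 1 ^ 2), y 2)
      = ∫⁻ y : ℝ × (Fin 2 → ℝ), φ (√(y.2 0 ^ 2 + y.2 1 ^ 2), y.1) :=
    (volume_preserving_piFinSuccAbove (fun _ : Fin 3 => ℝ) 2).lintegral_comp hm2
  have s3 : ∀ z : ℝ, ∫⁻ y : Fin 2 → ℝ, φ (√(y 0 ^ 2 + y 1 ^ 2), z)
      = ENNReal.ofReal (2 * Real.pi) * ∫⁻ r in Ioi (0 : ℝ), ENNReal.ofReal r * φ (r, z) := by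
    intro z
    have hm1 : Measurable fun y : ℝ × ℝ => φ (√(y.1 ^ 2 + y.2 ^ 2), z) := by fun_prop
    have t1 : ∫⁻ y : Fin 2 → ℝ, φ (√(y 0 ^ 2 + y 1 ^ 2), z)
        = ∫⁻ y : ℝ × ℝ, φ (√(y.1 ^ 2 + y.2 ^ 2), z) :=
      (volume_preserving_finTwoArrow ℝ).lintegral_comp hm1
    have t2 : ∀ y ∈ polarCoord.target,
        ENNReal.ofReal y.1 • φ (√((polarCoord.symm y).1 ^ 2 + (polarCoord.symm y).2 ^ 2), z)
        = ENNReal.ofReal y.1 * φ (y.1, z) := by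
      rintro ⟨r, θ⟩ hy
      have hr : 0 < r := hy.1
      have : (r * Real.cos θ) ^ 2 + (r * Real.sin θ) ^ 2 = r ^ 2 := by
        linear_combination r ^ 2 * Real.sin_sq_add_cos_sq θ
      simp [polarCoord_symm_apply, this, Real.sqrt_sq hr.le]
    rw [t1, ← lintegral_comp_polarCoord_symm,
      setLIntegral_congr_fun polarCoord.open_target.measurableSet t2, polarCoord_target,
      Measure.volume_eq_prod, ← Measure.prod_restrict, lintegral_prod _ (by fun_prop),
      ← lintegral_const_mul _ (by fun_prop)]
    refine lintegral_congr fun r => ?_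
    simp only [lintegral_const, Measure.restrict_apply MeasurableSet.univ, univ_inter,
      Real.volume_Ioo]
    rw [mul_comm]
    congr 2
    ring
  rw [s1, s2, Measure.volume_eq_prod, lintegral_prod _ hm2.aemeasurable]
  simp only [s3]
  rw [lintegral_const_mul _ (by fun_prop), Measure.volume_eq_prod, ← Measure.prod_restrict,
    lintegral_prod_symm _ (by fun_prop), Measure.restrict_univ]

lemma periodCell_eq (r₀ : ℝ) : periodCell r₀
    = (fun x : E3 => (cylRadius x, x 2)) ⁻¹' (Ioi r₀ ×ˢ Icc (-Real.pi) Real.pi) := rfl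

/-- Integrability over the period cell yields integrability in the variable `r`. -/
lemma integrableOn_slice {r₀ : ℝ} (hr₀ : 0 ≤ r₀) {f : ℝ × ℝ → ℝ}
    (hf : ContinuousOn f (meridian r₀)) (hf0 : ∀ x, 0 ≤ f x) {g : E3 → ℝ}
    (hg : IntegrableOn g (periodCell r₀))
    (hfg : ∀ x ∈ periodCell r₀, f (cylRadius x, x 2) ≤ g x) :
    IntegrableOn (fun r => r * ∫ z in (-Real.pi)..Real.pi, f (r, z)) (Ioi r₀) := by
  set A : Set (ℝ × ℝ) := Ioi r₀ ×ˢ Icc (-Real.pi) Real.pi with hA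
  have hAm : MeasurableSet A := measurableSet_Ioi.prod measurableSet_Icc
  have hAsub : A ⊆ meridian r₀ := fun x hx => hx.1
  have hcell : MeasurableSet (periodCell r₀) := by
    rw [periodCell_eq]
    exact (continuous_cylRadius.prodMk (by fun_prop)).measurable hAm
  -- Truncation to the cell gives a measurable function on the whole plane, although f is controlled
  -- only for r > r₀. Working with extended nonnegative integrals lets finiteness pass through the
  -- change of variables.
  set φ : ℝ × ℝ → ENNReal := A.indicator fun x => ENNReal.ofReal (f x) with hφdef
  have hφ : Measurable φ := by
    classical
    rw [hφdef, ← piecewise_eq_indicator]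
    exact (ENNReal.continuous_ofReal.comp_continuousOn (hf.mono hAsub)).measurable_piecewise
      continuousOn_const hAm
  have h1 : ∫⁻ x : E3, φ (cylRadius x, x 2) < ⊤ := by
    refine lt_of_le_of_lt (lintegral_mono (g := (periodCell r₀).indicator fun x => ‖g x‖ₑ)
      fun x => ?_) ?_
    · by_cases hx : x ∈ periodCell r₀
      · have hx' : (cylRadius x, x 2) ∈ A := hx
        rw [hφdef, indicator_of_mem hx', indicator_of_mem hx]
        have h2 := hfg x hx
        rw [Real.enorm_eq_ofReal ((hf0 _).trans h2)]
        exact ENNReal.ofReal_le_ofReal h2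
      · have hx' : (cylRadius x, x 2) ∉ A := hx
        rw [hφdef, indicator_of_notMem hx']
        exact zero_le
    · rw [lintegral_indicator hcell]
      exact hg.2
  rw [lintegral_cylindrical hφ] at h1
  have h2 : ∫⁻ y in Ioi (0 : ℝ) ×ˢ univ, ENNReal.ofReal y.1 * φ y < ⊤ := by
    refine lt_top_iff_ne_top.2 fun h => ?_
    rw [h, ENNReal.mul_top (by simp [Real.pi_pos])] at h1
    exact lt_irrefl _ h1
  have h3 : IntegrableOn (fun y => y.1 * f y) A := by
    refine ⟨(continuousOn_fst.mul (hf.mono hAsub)).aestronglyMeasurable hAm, ?_⟩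
    refine lt_of_le_of_lt ?_ h2
    calc _ = ∫⁻ y in A, ENNReal.ofReal y.1 * φ y := by
          refine setLIntegral_congr_fun hAm fun y hy => ?_
          have hy0 : 0 ≤ y.1 := hr₀.trans (le_of_lt hy.1)
          simp only [hφdef, indicator_of_mem hy]
          rw [Real.enorm_eq_ofReal (mul_nonneg hy0 (hf0 y)), ENNReal.ofReal_mul hy0]
      _ ≤ _ := lintegral_mono_set fun y (hy : y ∈ A) =>
          (show y ∈ Ioi (0 : ℝ) ×ˢ univ from ⟨hr₀.trans_lt hy.1, mem_univ _⟩)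
  rw [IntegrableOn, hA, Measure.volume_eq_prod, ← Measure.prod_restrict] at h3
  refine h3.integral_prod_left.congr (.of_forall fun r => ?_)
  simp only
  rw [integral_const_mul, intervalIntegral.integral_of_le (by linarith [Real.pi_pos]),
    integral_Icc_eq_integral_Ioc]

/-! ### Decay of the vorticity -/

section Decay

variable {r₀ : ℝ} {v : E3 → E3} {p : E3 → ℝ}

lemma gradNorm_nonneg (v : E3 → E3) (x : E3) : 0 ≤ gradNorm v x := Real.sqrt_nonneg _

/-- The decay of `ω^θ / r`, uniformly in `z`. -/
lemma eventually_vorticity_le {q : ℝ} (hr₀ : 0 ≤ r₀) (hq : 2 ≤ q)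
    (hNS : IsPeriodicSteadyNS r₀ v p) (hv : AxisymVector r₀ v) (hs : NoSwirl r₀ v)
    (hDir : IntegrableOn (fun x => gradNorm v x ^ q) (periodCell r₀)) {ε : ℝ} (hε : 0 < ε) :
    ∀ᶠ r in atTop, ∀ z ∈ Icc (-Real.pi) Real.pi,
      |merVort v (r, z) / r| ≤ ε * r ^ (-(1 + 2 / q)) := by
  have hU := merU_smooth hr₀ hNS.smooth_v
  have hW := merW_smooth hr₀ hNS.smooth_v
  have hvort : SmoothMer r₀ (merVort v) := hU.dZ.sub hW.dR
  have hq0 : 0 ≤ q := by linarith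
  have hrpow : ∀ {F : ℝ × ℝ → ℝ}, ContinuousOn F (meridian r₀) →
      ContinuousOn (fun x => |F x| ^ q) (meridian r₀) := fun hF =>
    hF.abs.rpow_const fun _ _ => Or.inr hq0
  have h1 : IntegrableOn (fun r => r * ∫ z in (-Real.pi)..Real.pi, |dZ (merU v) (r, z)| ^ q)
      (Ioi r₀) := by
    refine integrableOn_slice hr₀ (f := fun x => |dZ (merU v) x| ^ q)
      (hrpow hU.dZ.continuousOn) (fun x => by positivity) hDir fun x hx => ?_
    obtain ⟨θ, hθ⟩ := exists_eq_cylPoint x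
    have h2 := abs_dZ_merU_le hr₀ hNS.smooth_v hv hs hx.1 θ (x 2)
    rw [← hθ] at h2
    exact Real.rpow_le_rpow (abs_nonneg _) h2 hq0
  have h2 : IntegrableOn (fun r => r * ∫ z in (-Real.pi)..Real.pi, |merVort v (r, z)| ^ q)
      (Ioi r₀) := by
    refine integrableOn_slice hr₀ (f := fun x => |merVort v x| ^ q)
      -- The factor 2^q comes from |ω^θ| ≤ |∂_zU| + |∂_rW| ≤ 2|∇v|.
      (hrpow hvort.continuousOn) (fun x => by positivity) (hDir.const_mul (2 ^ q)) fun x hx => ?_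
    obtain ⟨θ, hθ⟩ := exists_eq_cylPoint x
    have e1 := abs_dZ_merU_le hr₀ hNS.smooth_v hv hs hx.1 θ (x 2)
    have e2 := abs_dR_merW_le hr₀ hNS.smooth_v hv hs hx.1 θ (x 2)
    rw [← hθ] at e1 e2
    rw [← Real.mul_rpow zero_le_two (gradNorm_nonneg v x)]
    refine Real.rpow_le_rpow (abs_nonneg _) ?_ hq0
    have e3 : |merVort v (cylRadius x, x 2)|
        ≤ |dZ (merU v) (cylRadius x, x 2)| + |dR (merW v) (cylRadius x, x 2)| := abs_sub _ _
    linarith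
  refine (meridionalFlow hr₀ hNS hv hs).eventually_decay hq le_rfl h1 ?_ hε
  refine h2.congr_fun (fun r hr => ?_) measurableSet_Ioi
  have hr' : r ≠ 0 := (hr₀.trans_lt hr).ne'
  simp only [mul_div_cancel₀ _ hr']

/-- A uniform bound `o(r⁻ˢ)` along the cylinders implies decay of the suprema `supZ`. -/
lemma tendsto_mul_supZ {f : E3 → ℝ} {θ s t : ℝ} (hts : t ≤ s)
    (hf : ∀ ε > 0, ∀ᶠ r in atTop, ∀ z ∈ Icc (-Real.pi) Real.pi,
      |f (cylPoint r θ z)| ≤ ε * r ^ (-s)) :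
    Tendsto (fun r : ℝ => r ^ t * supZ f θ r) atTop (𝓝 0) := by
  rw [Metric.tendsto_nhds]
  intro ε hε
  filter_upwards [hf (ε / 2) (by positivity), eventually_ge_atTop 1] with r hr hr1
  have hr0 : 0 < r := by linarith
  have : Nonempty (Icc (-Real.pi) Real.pi) := ⟨⟨0, by simp [Real.pi_pos.le]⟩⟩
  have h1 : supZ f θ r ≤ ε / 2 * r ^ (-s) := ciSup_le fun z => hr z z.2
  have h2 : 0 ≤ supZ f θ r := Real.iSup_nonneg fun _ => abs_nonneg _
  have h3 : r ^ t * supZ f θ r ≤ ε / 2 := by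
    calc r ^ t * supZ f θ r ≤ r ^ s * (ε / 2 * r ^ (-s)) :=
          mul_le_mul (Real.rpow_le_rpow_of_exponent_le hr1 hts) h1 h2 (by positivity)
      _ = ε / 2 * (r ^ s * r ^ (-s)) := by ring
      _ = ε / 2 := by rw [← Real.rpow_add hr0]; simp
  rw [Real.dist_eq, sub_zero, abs_of_nonneg (by positivity)]
  linarith

end Decay

theorem theorem1 (r₀ : ℝ) (hr₀ : 0 < r₀) (q : ℝ) (hq : 2 ≤ q)
    (v : E3 → E3) (p : E3 → ℝ)
    (hNS : IsPeriodicSteadyNS r₀ v p)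
    (hv : AxisymVector r₀ v) (hp : AxisymScalar r₀ p)
    (hswirl : NoSwirl r₀ v)
    (hDir : IntegrableOn (fun x => gradNorm v x ^ q) (periodCell r₀) volume)
    (θ : ℝ) :
    (2 < q →
      Tendsto (fun r : ℝ => r ^ (1 + 2 / q - 1 / q ^ 2) * supZ (bigOmega v) θ r)
        atTop (𝓝 0)) ∧
    (q = 2 →
      Tendsto (fun r : ℝ => r ^ (3 / 2 : ℝ) * supZ (bigOmega v) θ r) atTop (𝓝 0)) ∧
    (2 < q →
      Tendsto (fun r : ℝ => r ^ (2 / q - 1 / q ^ 2) * supZ (omegaTheta v) θ r)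
        atTop (𝓝 0)) ∧
    (q = 2 →
      Tendsto (fun r : ℝ => r ^ (1 / 2 : ℝ) * supZ (omegaTheta v) θ r) atTop (𝓝 0)) := by
  have hOm : ∀ ε > 0, ∀ᶠ r in atTop, ∀ z ∈ Icc (-Real.pi) Real.pi,
      |bigOmega v (cylPoint r θ z)| ≤ ε * r ^ (-(1 + 2 / q)) := by
    intro ε hε
    filter_upwards [eventually_vorticity_le hr₀.le hq hNS hv hswirl hDir hε,
      eventually_gt_atTop r₀] with r h hr z hz
    rw [bigOmega, omegaTheta_cylPoint hr₀.le hNS.smooth_v hv hswirl hr,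
      cylRadius_cylPoint (hr₀.trans hr).le]
    exact h z hz
  have hom : ∀ ε > 0, ∀ᶠ r in atTop, ∀ z ∈ Icc (-Real.pi) Real.pi,
      |omegaTheta v (cylPoint r θ z)| ≤ ε * r ^ (-(2 / q)) := by
    intro ε hε
    filter_upwards [hOm ε hε, eventually_gt_atTop r₀] with r h hr z hz
    have hr' : 0 < r := hr₀.trans hr
    have h1 := h z hz
    rw [bigOmega, cylRadius_cylPoint hr'.le, abs_div, abs_of_pos hr', div_le_iff₀ hr'] at h1
    refine h1.trans_eq ?_
    rw [mul_assoc, ← Real.rpow_add_one hr'.ne']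
    ring_nf
  have hsq : 0 ≤ 1 / q ^ 2 := by positivity
  -- The exponents proved are 1 + 2/q and 2/q. They exceed the stated ones by 1/q² for q > 2 and by
  -- 1/2 for q = 2.
  exact ⟨fun _ => tendsto_mul_supZ (by linarith) hOm,
    fun h => tendsto_mul_supZ (by rw [h]; norm_num) hOm,
    fun _ => tendsto_mul_supZ (by linarith) hom,
    fun h => tendsto_mul_supZ (by rw [h]; norm_num) hom⟩
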